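/- Let $X$ be a compact complex manifold with a Kähler metric $g$ (that is, a smooth Riemannian metric which is Hermitian for the complex structure $I$, and whose fundamental form $\omega(v,w)=g(Iv,w)$ is closed), and let $G$ be a finite group acting on $X$ by holomorphic isometries. Let $\Gamma_1,\Gamma_2\subseteq G$ be subgroups that act freely on $X$ and that are almost conjugate in $G$: every conjugacy class of $G$ contains as many elements of $\Gamma_1$ as of $\Gamma_2$. Give $\Gamma_i\backslash X$ the complex structure and the Riemannian metric induced from $X$. Then for all $p,q\ge 0$ the Hodge Laplacians $\Delta=d\delta+\delta d$ on the smooth complex-valued $(p,q)$-forms of $\Gamma_1\backslash X$ and of $\Gamma_2\backslash X$ are isospectral: for every $\mu\in\mathbb{C}$, the spaces $$\{\alpha\in\mathcal{A}^{p,q}(\Gamma_1\backslash X)\;:\;\Delta\alpha=\mu\alpha\}\quad\text{and}\quad\{\alpha\in\mathcal{A}^{p,q}(\Gamma_2\backslash X)\;:\;\Delta\alpha=\mu\alpha\}$$ have the same dimension. -/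

import Mathlib

open scoped Manifold ContDiff Topology
open Module

noncomputable section
namespace KahlerQuotient

set_option linter.unusedSectionVars false

section LinearAlgebra

variable {V : Type*} [NormedAddCommGroup V] [NormedSpace ℂ V] [FiniteDimensional ℂ V]
variable {n k m : ℕ}

/-- A real basis of the complex vector space `V`: a complex basis together with its multiples by
`I`, hence positively oriented for the complex orientation. -/
def realBasis (V : Type*) [NormedAddCommGroup V] [NormedSpace ℂ V] [FiniteDimensional ℂ V] :
    Basis (Fin (finrank ℂ V * 2)) ℝ V :=
  (Complex.basisOneI.smulTower (Module.finBasis ℂ V)).reindex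
    ((Equiv.prodComm _ _).trans finProdFinEquiv)

/-- The Gram matrix of `g` in the basis `b`. -/
def gram (b : Basis (Fin n) ℝ V) (g : V →L[ℝ] V →L[ℝ] ℝ) : Matrix (Fin n) (Fin n) ℝ :=
  Matrix.of fun i j => g (b i) (b j)

/-- The basis dual to `b` with respect to `g`: `g (reciprocal b g i) (b j) = δ i j`. -/
def reciprocal (b : Basis (Fin n) ℝ V) (g : V →L[ℝ] V →L[ℝ] ℝ) (i : Fin n) : V :=
  ∑ j, (gram b g)⁻¹ i j • b j

/-- The determinant in the basis `b`. -/
def detForm (b : Basis (Fin n) ℝ V) : V [⋀^Fin n]→L[ℝ] ℝ :=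
  { b.det with
    cont := by
      have : FiniteDimensional ℝ V := FiniteDimensional.complexToReal V
      change Continuous fun v : Fin n → V => b.det v
      simp only [Basis.det_apply]
      refine Continuous.matrix_det ?_
      refine continuous_matrix fun i j => ?_
      simp only [Basis.toMatrix_apply]
      exact (LinearMap.continuous_of_finiteDimensional (b.coord i)).comp (continuous_apply j) }

/-- The Riemannian volume form of `g`, for the orientation given by `b`. -/
def volumeForm (b : Basis (Fin n) ℝ V) (g : V →L[ℝ] V →L[ℝ] ℝ) : V [⋀^Fin n]→L[ℝ] ℝ :=
  √(gram b g).det • detForm b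

theorem volumeForm_apply (b : Basis (Fin n) ℝ V) (g : V →L[ℝ] V →L[ℝ] ℝ) (v : Fin n → V) :
    volumeForm b g v = √(gram b g).det * b.det v := rfl

/-- `(ι_{u_1, …, u_k} φ)(v) = φ(u_1, …, u_k, v_1, …, v_m)`. -/
def contractLeft (φ : V [⋀^Fin n]→L[ℝ] ℝ) (h : k + m = n) (u : Fin k → V) :
    V [⋀^Fin m]→L[ℝ] ℝ where
  toFun v := φ (Fin.append u v ∘ Fin.cast h.symm)
  map_update_add' {_} v i x y := by
    subst h
    obtain rfl : ‹DecidableEq (Fin m)› = instDecidableEqFin m := Subsingleton.elim _ _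
    have key (z : V) : Fin.append u (Function.update v i z) =
        Function.update (Fin.append u v) (Fin.natAdd k i) z := by
      ext j
      refine Fin.addCases (fun j => ?_) (fun j => ?_) j
      · have : Fin.castAdd m j ≠ Fin.natAdd k i := by
          intro h; have := congrArg Fin.val h; simp at this; omega
        simp [Function.update_of_ne this]
      · simp [Function.update_apply]
    simp only [Fin.cast_refl, Function.comp_id, key]
    exact φ.map_update_add _ _ _ _
  map_update_smul' {_} v i c x := by
    subst h
    obtain rfl : ‹DecidableEq (Fin m)› = instDecidableEqFin m := Subsingleton.elim _ _
    have key (z : V) : Fin.append u (Function.update v i z) =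
        Function.update (Fin.append u v) (Fin.natAdd k i) z := by
      ext j
      refine Fin.addCases (fun j => ?_) (fun j => ?_) j
      · have : Fin.castAdd m j ≠ Fin.natAdd k i := by
          intro h; have := congrArg Fin.val h; simp at this; omega
        simp [Function.update_of_ne this]
      · simp [Function.update_apply]
    simp only [Fin.cast_refl, Function.comp_id, key]
    exact φ.map_update_smul _ _ _ _
  map_eq_zero_of_eq' v i j hv hij := by
    subst h
    refine φ.map_eq_zero_of_eq _ (i := Fin.natAdd k i) (j := Fin.natAdd k j) (by simpa using hv)
      (by simpa using hij)
  cont := by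
    subst h
    refine φ.cont.comp (continuous_pi fun j => ?_)
    refine Fin.addCases (fun j => ?_) (fun j => ?_) j
    · simpa using continuous_const
    · simpa using continuous_apply j

theorem contractLeft_apply (φ : V [⋀^Fin n]→L[ℝ] ℝ) (h : k + m = n) (u : Fin k → V)
    (v : Fin m → V) : contractLeft φ h u v = φ (Fin.append u v ∘ Fin.cast h.symm) := rfl

/-- The complex linear Hodge star `Λ^k V* ⊗ ℂ → Λ^m V* ⊗ ℂ`, where `k + m` is the real dimension of
`V`: `(⋆β)(v) = (1/k!) ∑ β(e^{f 1}, …, e^{f k}) vol(e_{f 1}, …, e_{f k}, v_1, …, v_m)`, which is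
the operator with `α ∧ ⋆β = ⟨α, β⟩ vol`. It is set to be zero if `k + m` is not the dimension. -/
def pointStar (b : Basis (Fin n) ℝ V) (g : V →L[ℝ] V →L[ℝ] ℝ) (k m : ℕ)
    (β : V [⋀^Fin k]→L[ℝ] ℂ) : V [⋀^Fin m]→L[ℝ] ℂ :=
  if h : k + m = n then
    (k.factorial : ℝ)⁻¹ • ∑ f : Fin k → Fin n,
      (contractLeft (volumeForm b g) h (b ∘ f)).smulRight (β (reciprocal b g ∘ f))
  else 0

theorem multilinear_change (P : MultilinearMap ℝ (fun _ : Fin k => V) ℝ)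
    (Q : MultilinearMap ℝ (fun _ : Fin k => V) ℂ) (A B : Matrix (Fin n) (Fin n) ℝ)
    (h : A.transpose * B = 1) (b b' : Fin n → V) :
    ∑ f : Fin k → Fin n, P (fun i => ∑ j, A (f i) j • b j) • Q (fun i => ∑ j, B (f i) j • b' j) =
      ∑ f : Fin k → Fin n, P (b ∘ f) • Q (b' ∘ f) := by
  classical
  have hAB (r s : Fin n) : ∑ a, A a r * B a s = if r = s then 1 else 0 := by
    have := congrFun (congrFun h r) s
    simpa [Matrix.mul_apply, Matrix.one_apply] using this
  have key (r s : Fin k → Fin n) : ∑ f : Fin k → Fin n, (∏ i, A (f i) (r i)) * (∏ i, B (f i) (s i)) =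
      if r = s then 1 else 0 := by
    simp only [← Finset.prod_mul_distrib]
    have hps := Finset.prod_univ_sum (fun _ : Fin k => (Finset.univ : Finset (Fin n)))
      (fun i a => A a (r i) * B a (s i))
    rw [Fintype.piFinset_univ] at hps
    rw [← hps]
    simp only [hAB]
    by_cases hrs : r = s
    · simp [hrs]
    · obtain ⟨i, hi⟩ := Function.ne_iff.mp hrs
      rw [if_neg hrs]
      exact Finset.prod_eq_zero (Finset.mem_univ i) (by simp [hi])
  calc _ = ∑ f : Fin k → Fin n, ∑ r : Fin k → Fin n, ∑ s : Fin k → Fin n,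
        ((∏ i, A (f i) (r i)) * (∏ i, B (f i) (s i))) • (P (b ∘ r) • Q (b' ∘ s)) := by
        refine Finset.sum_congr rfl fun f _ => ?_
        rw [MultilinearMap.map_sum, MultilinearMap.map_sum, Finset.sum_smul]
        refine Finset.sum_congr rfl fun r _ => ?_
        rw [Finset.smul_sum]
        refine Finset.sum_congr rfl fun s _ => ?_
        rw [MultilinearMap.map_smul_univ, MultilinearMap.map_smul_univ]
        simp only [smul_smul, smul_eq_mul, Function.comp_def]
        congr 1; ring
    _ = ∑ r : Fin k → Fin n, ∑ s : Fin k → Fin n,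
        (if r = s then (1 : ℝ) else 0) • (P (b ∘ r) • Q (b' ∘ s)) := by
        rw [Finset.sum_comm]
        refine Finset.sum_congr rfl fun r _ => ?_
        rw [Finset.sum_comm]
        refine Finset.sum_congr rfl fun s _ => ?_
        rw [← Finset.sum_smul, key]
    _ = _ := by simp

theorem exists_contractLeft_multilinear (φ : V [⋀^Fin n]→L[ℝ] ℝ) (h : k + m = n) (v : Fin m → V) :
    ∃ P : MultilinearMap ℝ (fun _ : Fin k => V) ℝ, ∀ u, P u = contractLeft φ h u v := by
  subst h
  have key (u : Fin k → V) (i : Fin k) (z : V) : Fin.append (Function.update u i z) v =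
        Function.update (Fin.append u v) (Fin.castAdd m i) z := by
      ext j
      refine Fin.addCases (fun j => ?_) (fun j => ?_) j
      · simp [Function.update_apply]
      · have : Fin.natAdd k j ≠ Fin.castAdd m i := by
          intro h; have := congrArg Fin.val h; simp at this; omega
        simp [Function.update_of_ne this]
  refine ⟨MultilinearMap.mk' (fun u => contractLeft φ rfl u v) ?_ ?_, fun u => rfl⟩
  · intro u i x y
    simp only [contractLeft_apply, Fin.cast_refl, Function.comp_id, key]
    exact φ.map_update_add _ _ _ _
  · intro u i c x
    simp only [contractLeft_apply, Fin.cast_refl, Function.comp_id, key]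
    exact φ.map_update_smul _ _ _ _

theorem pointStar_map_basis (b : Basis (Fin n) ℝ V) (T : V ≃ₗ[ℂ] V) (g : V →L[ℝ] V →L[ℝ] ℝ)
    (k m : ℕ) (β : V [⋀^Fin k]→L[ℝ] ℂ) :
    pointStar (b.map (T.restrictScalars ℝ)) g k m β = pointStar b g k m β := by
  classical
  set c := b.map (T.restrictScalars ℝ) with hc
  unfold pointStar
  split_ifs with h
  swap; · rfl
  set A : Matrix (Fin n) (Fin n) ℝ := (b.toMatrix c).transpose with hA
  have hcb (i : Fin n) : c i = ∑ j, A i j • b j := by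
    simp only [hA, Matrix.transpose_apply]
    exact (b.sum_toMatrix_smul_self c i).symm
  have hdet : 0 < A.det := by
    rw [hA, Matrix.det_transpose, ← Basis.det_apply]
    have h1 : b.det c = LinearMap.det (T.restrictScalars ℝ : V →ₗ[ℝ] V) := by
      have : (c : Fin n → V) = (T.restrictScalars ℝ : V →ₗ[ℝ] V) ∘ b := by
        ext i; simp [hc]
      rw [this, Basis.det_comp, Basis.det_self, mul_one]
    rw [h1]
    have h2 : (T.restrictScalars ℝ : V →ₗ[ℝ] V) = (T : V →ₗ[ℂ] V).restrictScalars ℝ := rfl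
    rw [h2, LinearMap.det_restrictScalars, Algebra.norm_complex_apply, Complex.normSq_pos]
    exact (LinearEquiv.isUnit_det' T).ne_zero
  have hAu : IsUnit A.det := isUnit_iff_ne_zero.mpr hdet.ne'
  have hgram : gram c g = A * gram b g * A.transpose := by
    ext i j
    simp only [gram, Matrix.of_apply, Matrix.mul_apply, Matrix.transpose_apply]
    rw [hcb i, hcb j]
    simp only [map_sum, map_smul, _root_.sum_apply, _root_.smul_apply,
      smul_eq_mul, Finset.sum_mul, Finset.mul_sum]
    refine Finset.sum_congr rfl fun x _ => Finset.sum_congr rfl fun y _ => by ring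
  have hrec (i : Fin n) : reciprocal c g i = ∑ j, (A.transpose)⁻¹ i j • reciprocal b g j := by
    have hinv : (gram c g)⁻¹ * A = (A.transpose)⁻¹ * (gram b g)⁻¹ := by
      rw [hgram, Matrix.mul_inv_rev, Matrix.mul_inv_rev, Matrix.mul_assoc, Matrix.mul_assoc,
        Matrix.nonsing_inv_mul _ hAu, Matrix.mul_one]
    have e1 : reciprocal c g i = ∑ j, ((gram c g)⁻¹ * A) i j • b j := by
      simp only [reciprocal, hcb, Matrix.mul_apply, Finset.smul_sum, Finset.sum_smul, smul_smul]
      rw [Finset.sum_comm]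
    rw [e1, hinv]
    simp only [reciprocal, Matrix.mul_apply, Finset.smul_sum, Finset.sum_smul, smul_smul]
    rw [Finset.sum_comm]
  have hvol : volumeForm c g = volumeForm b g := by
    ext v
    rw [volumeForm_apply, volumeForm_apply, hgram, Matrix.det_mul, Matrix.det_mul,
      A.det_transpose]
    have h3 : b.det v = A.det * c.det v := by
      have := congrArg (fun φ => φ v) (b.det.eq_smul_basis_det c)
      rw [hA, Matrix.det_transpose, ← Basis.det_apply]
      simpa using this
    have h4 : A.det * (gram b g).det * A.det = A.det ^ 2 * (gram b g).det := by ring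
    rw [h3, h4, Real.sqrt_mul (sq_nonneg _), Real.sqrt_sq hdet.le]
    ring
  congr 1
  ext v
  simp only [ContinuousAlternatingMap.sum_apply, ContinuousAlternatingMap.smulRight_apply]
  obtain ⟨P, hP⟩ := exists_contractLeft_multilinear (volumeForm b g) h v
  have := multilinear_change P β.toMultilinearMap A (A.transpose)⁻¹
    (Matrix.mul_nonsing_inv _ (by simpa using hAu)) b (reciprocal b g)
  simp only [hP] at this
  rw [hvol]
  convert this using 3 with f
  · congr 2
    funext i
    exact hcb (f i)
  · change β _ = β _
    congr 1
    funext i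
    exact hrec (f i)
  · rfl

theorem pointStar_comp (b : Basis (Fin n) ℝ V) (T : V ≃ₗ[ℂ] V) (D : V →L[ℝ] V)
    (hD : ∀ v, D v = T v) (g g' : V →L[ℝ] V →L[ℝ] ℝ)
    (hg : ∀ v w, g' v w = g (D v) (D w)) (k m : ℕ) (β : V [⋀^Fin k]→L[ℝ] ℂ) :
    pointStar b g' k m (β.compContinuousLinearMap D) =
      (pointStar b g k m β).compContinuousLinearMap D := by
  classical
  rw [← pointStar_map_basis b T g]
  set c := b.map (T.restrictScalars ℝ) with hc
  have hcb (i : Fin n) : c i = D (b i) := by simp [hc, hD]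
  unfold pointStar
  split_ifs with h
  swap; · rfl
  have hgram : gram c g = gram b g' := by
    ext i j; simp [gram, hcb, hg]
  have hrec (i : Fin n) : reciprocal c g i = D (reciprocal b g' i) := by
    simp [reciprocal, hcb, hgram]
  have hvol (v : Fin n → V) : volumeForm c g (D ∘ v) = volumeForm b g' v := by
    rw [volumeForm_apply, volumeForm_apply, hgram, hc, Basis.det_map]
    congr 2
    ext i
    simp [hD]
  ext v
  simp only [ContinuousAlternatingMap.sum_apply, ContinuousAlternatingMap.smul_apply,
    ContinuousAlternatingMap.smulRight_apply, ContinuousAlternatingMap.compContinuousLinearMap_apply]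
  congr 1
  refine Finset.sum_congr rfl fun f _ => ?_
  congr 1
  · rw [contractLeft_apply, contractLeft_apply, ← hvol]
    congr 1
    subst h
    ext j
    refine Fin.addCases (fun j => ?_) (fun j => ?_) j <;> simp [hcb]
  · congr 1
    ext i
    simp [hrec]

theorem pointStar_add (b : Basis (Fin n) ℝ V) (g : V →L[ℝ] V →L[ℝ] ℝ) (k m : ℕ)
    (β γ : V [⋀^Fin k]→L[ℝ] ℂ) :
    pointStar b g k m (β + γ) = pointStar b g k m β + pointStar b g k m γ := by
  unfold pointStar
  split_ifs with h
  · ext v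
    simp only [ContinuousAlternatingMap.add_apply, ContinuousAlternatingMap.smul_apply,
      ContinuousAlternatingMap.sum_apply, ContinuousAlternatingMap.smulRight_apply, ← smul_add,
      ← Finset.sum_add_distrib]
  · simp

theorem pointStar_smul (b : Basis (Fin n) ℝ V) (g : V →L[ℝ] V →L[ℝ] ℝ) (k m : ℕ)
    (a : ℂ) (β : V [⋀^Fin k]→L[ℝ] ℂ) :
    pointStar b g k m (a • β) = a • pointStar b g k m β := by
  unfold pointStar
  by_cases h : k + m = n
  · simp only [dif_pos h]
    ext v
    simp only [ContinuousAlternatingMap.smul_apply, ContinuousAlternatingMap.sum_apply,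
      ContinuousAlternatingMap.smulRight_apply]
    simp only [Finset.smul_sum, Finset.mul_sum, Complex.real_smul, smul_eq_mul]
    refine Finset.sum_congr rfl fun f _ => ?_
    ring
  · simp only [dif_neg h]
    ext v
    simp

theorem gram_det_ne_zero (b : Basis (Fin n) ℝ V) (g : V →L[ℝ] V →L[ℝ] ℝ)
    (hg : ∀ v, v ≠ 0 → 0 < g v v) : (gram b g).det ≠ 0 := by
  intro h
  obtain ⟨x, hx, hx0⟩ := Matrix.exists_mulVec_eq_zero_iff.mpr h
  have hv : (∑ i, x i • b i) ≠ 0 := by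
    intro h0
    exact hx (funext fun i => Fintype.linearIndependent_iff.mp b.linearIndependent x h0 i)
  refine (hg _ hv).ne' ?_
  have (i : Fin n) : g (b i) (∑ j, x j • b j) = 0 := by
    have := congrFun hx0 i
    simpa [Matrix.mulVec, dotProduct, gram, mul_comm] using this
  set v := ∑ j, x j • b j with hvdef
  have e : g v = ∑ j, x j • g (b j) := by rw [hvdef, map_sum]; simp only [map_smul]
  rw [e, _root_.sum_apply]
  refine Finset.sum_eq_zero fun i _ => ?_
  rw [_root_.smul_apply, this, smul_zero]

variable {W : Type*} [NormedAddCommGroup W] [NormedSpace ℝ W]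

theorem contDiffAt_det {A : W → Matrix (Fin n) (Fin n) ℝ} {y : W}
    (hA : ∀ i j, ContDiffAt ℝ ∞ (fun y => A y i j) y) : ContDiffAt ℝ ∞ (fun y => (A y).det) y := by
  simp only [Matrix.det_apply, Units.smul_def, zsmul_eq_mul]
  refine ContDiffAt.sum fun σ _ => ?_
  refine contDiffAt_const.mul (contDiffAt_prod fun i _ => hA _ _)

theorem contDiffAt_pointStar (b : Basis (Fin n) ℝ V) (k m : ℕ) {G : W → V →L[ℝ] V →L[ℝ] ℝ}
    {β : W → V [⋀^Fin k]→L[ℝ] ℂ} {y : W} (hG : ContDiffAt ℝ ∞ G y) (hβ : ContDiffAt ℝ ∞ β y)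
    (hpos : ∀ v, v ≠ 0 → 0 < G y v v) :
    ContDiffAt ℝ ∞ (fun z => pointStar b (G z) k m (β z)) y := by
  classical
  unfold pointStar
  split_ifs with h
  swap; · exact contDiffAt_const
  have hgram (i j : Fin n) : ContDiffAt ℝ ∞ (fun z => gram b (G z) i j) y := by
    simp only [gram, Matrix.of_apply]
    exact (hG.clm_apply contDiffAt_const).clm_apply contDiffAt_const
  have hdet := contDiffAt_det hgram
  have hne := gram_det_ne_zero b (G y) hpos
  have hsqrt : ContDiffAt ℝ ∞ (fun z => √(gram b (G z)).det) y := hdet.sqrt hne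
  have hinv (i j : Fin n) : ContDiffAt ℝ ∞ (fun z => (gram b (G z))⁻¹ i j) y := by
    simp only [Matrix.inv_def, Ring.inverse_eq_inv', Matrix.smul_apply, smul_eq_mul,
      Matrix.adjugate_apply]
    refine (hdet.inv hne).mul (contDiffAt_det fun r s => ?_)
    by_cases hr : r = j
    · subst hr
      simpa using contDiffAt_const
    · simpa [Matrix.updateRow_apply, hr] using hgram r s
  have hev (u : Fin k → V) : ContDiffAt ℝ ∞ (fun z => β z u) y :=
    ((ContinuousAlternatingMap.apply ℝ V ℂ u).contDiff.contDiffAt).comp y hβ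
  have hterm (f : Fin k → Fin n) :
      ContDiffAt ℝ ∞ (fun z => β z (reciprocal b (G z) ∘ f)) y := by
    have e (z : W) : β z (reciprocal b (G z) ∘ f) =
        ∑ r : Fin k → Fin n, (∏ i, (gram b (G z))⁻¹ (f i) (r i)) • β z (b ∘ r) := by
      have e1 : (reciprocal b (G z) ∘ f) = fun i => ∑ j, (gram b (G z))⁻¹ (f i) j • b j := rfl
      rw [e1]
      refine ((β z).toMultilinearMap.map_sum _).trans ?_
      refine Finset.sum_congr rfl fun r _ => ?_
      exact (β z).toMultilinearMap.map_smul_univ _ _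
    simp only [e]
    refine ContDiffAt.sum fun r _ => ?_
    exact ContDiffAt.fun_smul (contDiffAt_prod fun i _ => hinv (f i) (r i)) (hev (b ∘ r))
  have hform (z : W) (f : Fin k → Fin n) :
      (contractLeft (volumeForm b (G z)) h (b ∘ f)).smulRight (β z (reciprocal b (G z) ∘ f)) =
      √(gram b (G z)).det • (ContinuousAlternatingMap.smulRight
        (contractLeft (detForm b) h (b ∘ f)) (β z (reciprocal b (G z) ∘ f))) := by
    ext v
    simp only [ContinuousAlternatingMap.smul_apply, ContinuousAlternatingMap.smulRight_apply,
      contractLeft_apply, volumeForm, smul_smul, smul_eq_mul]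
  simp only [hform]
  refine ContDiffAt.fun_smul contDiffAt_const
    (ContDiffAt.sum fun f _ => ContDiffAt.fun_smul hsqrt ?_)
  let Λ : ℂ →ₗ[ℝ] V [⋀^Fin m]→L[ℝ] ℂ :=
    { toFun := fun a => (contractLeft (detForm b) h (b ∘ f)).smulRight a
      map_add' := fun a c => by ext v; simp
      map_smul' := fun r a => by ext v; simp [mul_left_comm] }
  exact ((LinearMap.toContinuousLinearMap Λ).contDiff.contDiffAt).comp y (hterm f)

end LinearAlgebra

section Forms

variable {E : Type*} [NormedAddCommGroup E] [NormedSpace ℂ E]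
variable {X : Type*} [TopologicalSpace X] [ChartedSpace E X]
variable {k m : ℕ}

theorem isManifold_real {n : ℕ∞ω} [IsManifold 𝓘(ℂ, E) n X] : IsManifold 𝓘(ℝ, E) n X := by
  refine isManifold_of_contDiffOn 𝓘(ℝ, E) n X fun e e' he he' => ?_
  have h := HasGroupoid.compatible (G := contDiffGroupoid n 𝓘(ℂ, E)) he he'
  have h1 := (contDiffGroupoid n 𝓘(ℂ, E)).mem_iff_of_eqOnSource (Setoid.refl _) |>.mp h
  rw [contDiffGroupoid, mem_groupoid_of_pregroupoid] at h1
  have h2 := h1.1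
  simp only [contDiffPregroupoid, modelWithCornersSelf_coe, modelWithCornersSelf_coe_symm,
    Set.range_id, Set.preimage_id, Set.inter_univ] at h2 ⊢
  exact h2.restrict_scalars ℝ

instance isManifold_real_of_complex [IsManifold 𝓘(ℂ, E) ω X] : IsManifold 𝓘(ℝ, E) ω X :=
  isManifold_real

variable (E X k) in
/-- Complex valued differential `k`-forms on (the real manifold underlying) `X`. -/
def Form : Type _ := ∀ x : X, TangentSpace 𝓘(ℝ, E) x [⋀^Fin k]→L[ℝ] ℂ

instance : AddCommGroup (Form E X k) :=
  inferInstanceAs (AddCommGroup (∀ x : X, TangentSpace 𝓘(ℝ, E) x [⋀^Fin k]→L[ℝ] ℂ))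

instance : Module ℂ (Form E X k) :=
  inferInstanceAs (Module ℂ (∀ x : X, TangentSpace 𝓘(ℝ, E) x [⋀^Fin k]→L[ℝ] ℂ))

/-- The form `α` read in the chart at `x₀`, that is, its pull-back to the model space. -/
def inChart (x₀ : X) (α : Form E X k) (y : E) : E [⋀^Fin k]→L[ℝ] ℂ :=
  (α ((chartAt E x₀).symm y)).compContinuousLinearMap
    (mfderiv 𝓘(ℝ, E) 𝓘(ℝ, E) (chartAt E x₀).symm y)

/-- A form is smooth if it is smooth in the charts. -/
def IsSmoothForm (α : Form E X k) : Prop :=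
  ∀ x₀ : X, ContDiffOn ℝ ∞ (inChart x₀ α) (chartAt E x₀).target

/-- The exterior derivative, computed at `x` in the chart at `x`; see `inChart_extDer` for the other
charts. -/
def extDer (α : Form E X k) : Form E X (k + 1) := fun x =>
  (extDeriv (inChart x α) (chartAt E x x)).compContinuousLinearMap
    (mfderiv 𝓘(ℝ, E) 𝓘(ℝ, E) (chartAt E x) x)

theorem inChart_add (x₀ : X) (α β : Form E X k) :
    inChart x₀ (α + β) = inChart x₀ α + inChart x₀ β := rfl

theorem inChart_smul (x₀ : X) (c : ℂ) (α : Form E X k) :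
    inChart x₀ (c • α) = c • inChart x₀ α := rfl

theorem transition_contDiffAt {𝕜 : Type*} [NontriviallyNormedField 𝕜] {F : Type*}
    [NormedAddCommGroup F] [NormedSpace 𝕜 F] {M : Type*} [TopologicalSpace M] [ChartedSpace F M]
    {n : ℕ∞ω} [IsManifold 𝓘(𝕜, F) n M] (x₀ x₁ : M) {y : F}
    (hy : y ∈ (chartAt F x₀).target) (hy' : (chartAt F x₀).symm y ∈ (chartAt F x₁).source) :
    ContDiffAt 𝕜 n (chartAt F x₁ ∘ (chartAt F x₀).symm) y := by
  have h := contDiffWithinAt_ext_coord_change (I := 𝓘(𝕜, F)) (n := n) x₁ x₀ (y := y)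
    (by simp [hy, hy'])
  simpa [contDiffWithinAt_univ] using h

theorem mfderiv_symm_trans [IsManifold 𝓘(ℝ, E) ∞ X] (x₀ x₁ : X) {y : E}
    (hy : y ∈ (chartAt E x₀).target) (hy' : (chartAt E x₀).symm y ∈ (chartAt E x₁).source) :
    (mfderiv 𝓘(ℝ, E) 𝓘(ℝ, E) (chartAt E x₀).symm y : E →L[ℝ] E) =
      (mfderiv 𝓘(ℝ, E) 𝓘(ℝ, E) (chartAt E x₁).symm (chartAt E x₁ ((chartAt E x₀).symm y)) :
        E →L[ℝ] E).comp (fderiv ℝ (chartAt E x₁ ∘ (chartAt E x₀).symm) y) := by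
  have hτ := (transition_contDiffAt (𝕜 := ℝ) (n := ∞) x₀ x₁ hy hy').differentiableAt (by simp)
  have h1 : MDifferentiableAt 𝓘(ℝ, E) 𝓘(ℝ, E) (chartAt E x₁).symm
      ((chartAt E x₁ ∘ (chartAt E x₀).symm) y) :=
    mdifferentiableAt_atlas_symm (chart_mem_atlas E x₁) ((chartAt E x₁).map_source hy')
  have h2 := mfderiv_comp y h1 hτ.mdifferentiableAt
  rw [mfderiv_eq_fderiv] at h2
  have h3 : (chartAt E x₀).symm =ᶠ[𝓝 y]
      (chartAt E x₁).symm ∘ chartAt E x₁ ∘ (chartAt E x₀).symm := by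
    have : (chartAt E x₀).symm ⁻¹' (chartAt E x₁).source ∩ (chartAt E x₀).target ∈ 𝓝 y :=
      Filter.inter_mem (((chartAt E x₀).continuousAt_symm hy).preimage_mem_nhds
        ((chartAt E x₁).open_source.mem_nhds hy')) ((chartAt E x₀).open_target.mem_nhds hy)
    filter_upwards [this] with z hz
    exact ((chartAt E x₁).left_inv hz.1).symm
  exact (h3.mfderiv_eq (I := 𝓘(ℝ, E)) (I' := 𝓘(ℝ, E))).trans h2

theorem mfderiv_symm_self [IsManifold 𝓘(ℝ, E) ∞ X] (x : X) :
    (mfderiv 𝓘(ℝ, E) 𝓘(ℝ, E) (chartAt E x).symm (chartAt E x x) : E →L[ℝ] E) =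
      ContinuousLinearMap.id ℝ E := by
  have := mfderivWithin_range_extChartAt_symm (I := 𝓘(ℝ, E)) (x := x)
  simpa using! this

theorem mfderiv_self [IsManifold 𝓘(ℝ, E) ∞ X] (x : X) :
    (mfderiv 𝓘(ℝ, E) 𝓘(ℝ, E) (chartAt E x) x : E →L[ℝ] E) =
      ContinuousLinearMap.id ℝ E := by
  have := mfderiv_extChartAt_self (I := 𝓘(ℝ, E)) (x := x)
  simpa using! this

theorem inChart_trans [IsManifold 𝓘(ℝ, E) ∞ X] (α : Form E X k) (x₀ x₁ : X) {y : E}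
    (hy : y ∈ (chartAt E x₀).target) (hy' : (chartAt E x₀).symm y ∈ (chartAt E x₁).source) :
    inChart x₀ α y = (inChart x₁ α ((chartAt E x₁ ∘ (chartAt E x₀).symm) y)).compContinuousLinearMap
      (fderiv ℝ (chartAt E x₁ ∘ (chartAt E x₀).symm) y) := by
  unfold inChart
  have e : (chartAt E x₁).symm ((chartAt E x₁ ∘ (chartAt E x₀).symm) y) =
    (chartAt E x₀).symm y := (chartAt E x₁).left_inv hy'
  rw [e]
  ext v
  have := mfderiv_symm_trans x₀ x₁ hy hy'
  change (α ((chartAt E x₀).symm y)) _ = (α ((chartAt E x₀).symm y)) _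
  congr 1
  funext i
  exact DFunLike.congr_fun this (v i)

theorem inChart_extDer [IsManifold 𝓘(ℝ, E) ∞ X] {α : Form E X k} (hα : IsSmoothForm α) (x₀ : X)
    {y : E} (hy : y ∈ (chartAt E x₀).target) :
    inChart x₀ (extDer α) y = extDeriv (inChart x₀ α) y := by
  set x := (chartAt E x₀).symm y with hx
  have hxs := mem_chart_source E x
  set τ := chartAt E x ∘ (chartAt E x₀).symm with hτ
  have hev : inChart x₀ α =ᶠ[𝓝 y] fun z => (inChart x α (τ z)).compContinuousLinearMap
      (fderiv ℝ τ z) := by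
    have : (chartAt E x₀).symm ⁻¹' (chartAt E x).source ∩ (chartAt E x₀).target ∈ 𝓝 y :=
      Filter.inter_mem (((chartAt E x₀).continuousAt_symm hy).preimage_mem_nhds
        ((chartAt E x).open_source.mem_nhds hxs)) ((chartAt E x₀).open_target.mem_nhds hy)
    filter_upwards [this] with z hz
    exact inChart_trans α x₀ x hz.2 hz.1
  have hτy : τ y = chartAt E x x := rfl
  have hd : DifferentiableAt ℝ (inChart x α) (τ y) :=
    (((hα x).contDiffAt ((chartAt E x).open_target.mem_nhds
      ((chartAt E x).map_source hxs))).differentiableAt (by simp))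
  rw [hev.extDeriv_eq, extDeriv_pullback hd (transition_contDiffAt x₀ x hy hxs) (r := ∞)
    (by simpa using ENat.LEInfty.out)]
  have h1 := mfderiv_symm_trans x₀ x hy hxs
  have h2 := mfderiv_symm_self (E := E) x
  have h3 := mfderiv_self (E := E) x
  unfold inChart extDer
  ext v
  change extDeriv (inChart x α) (chartAt E x x) _ = extDeriv (inChart x α) (chartAt E x x) _
  congr 1
  funext i
  change (mfderiv 𝓘(ℝ, E) 𝓘(ℝ, E) (chartAt E x) x : E →L[ℝ] E)
    ((mfderiv 𝓘(ℝ, E) 𝓘(ℝ, E) (chartAt E x₀).symm y : E →L[ℝ] E) (v i)) = _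
  rw [h3, h1]
  change (mfderiv 𝓘(ℝ, E) 𝓘(ℝ, E) (chartAt E x).symm (chartAt E x x) : E →L[ℝ] E) _ = _
  rw [h2]
  rfl

theorem IsSmoothForm.extDer [IsManifold 𝓘(ℝ, E) ∞ X] {α : Form E X k} (hα : IsSmoothForm α) :
    IsSmoothForm (extDer α) := by
  intro x₀
  have h : ContDiffOn ℝ ∞ (extDeriv (inChart x₀ α)) (chartAt E x₀).target := by
    have h1 : ContDiffOn ℝ ∞ (fderiv ℝ (inChart x₀ α)) (chartAt E x₀).target :=
      (hα x₀).fderiv_of_isOpen (chartAt E x₀).open_target (by simp)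
    exact (ContinuousAlternatingMap.alternatizeUncurryFinCLM ℝ E ℂ).contDiff.comp_contDiffOn h1
  exact h.congr fun y hy => inChart_extDer hα x₀ hy

theorem extDeriv_complex_smul (c : ℂ) {η : E → E [⋀^Fin k]→L[ℝ] ℂ} {y : E}
    (h : DifferentiableAt ℝ η y) : extDeriv (c • η) y = c • extDeriv η y := by
  have h1 : fderiv ℝ (c • η) y = c • fderiv ℝ η y := fderiv_const_smul h c
  unfold extDeriv
  rw [h1]
  ext v
  change _ = c • ContinuousAlternatingMap.alternatizeUncurryFin (fderiv ℝ η y) v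
  simp only [ContinuousAlternatingMap.alternatizeUncurryFin_apply, Finset.smul_sum]
  refine Finset.sum_congr rfl fun i _ => ?_
  exact smul_comm _ _ _

variable (E X k) in
/-- The space of smooth complex valued `k`-forms. -/
def SmoothForm : Submodule ℂ (Form E X k) where
  carrier := {α | IsSmoothForm α}
  zero_mem' := fun _ => contDiffOn_const (c := 0)
  add_mem' := fun ha hb x₀ => (ha x₀).add (hb x₀)
  smul_mem' := fun c _ ha x₀ => (ha x₀).const_smul c

/-- The exterior derivative on smooth forms. -/
def d [IsManifold 𝓘(ℝ, E) ∞ X] : SmoothForm E X k →ₗ[ℂ] SmoothForm E X (k + 1) where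
  toFun α := ⟨extDer α.1, IsSmoothForm.extDer α.2⟩
  map_add' α β := by
    refine Subtype.ext (funext fun x => ?_)
    have hx := (chartAt E x).open_target.mem_nhds (mem_chart_target E x)
    have ha := ((α.2 x).contDiffAt hx).differentiableAt (by simp)
    have hb := ((β.2 x).contDiffAt hx).differentiableAt (by simp)
    change (extDeriv (inChart x α.1 + inChart x β.1) _).compContinuousLinearMap _ = _
    rw [extDeriv_add ha hb]
    rfl
  map_smul' c α := by
    refine Subtype.ext (funext fun x => ?_)
    have hx := (chartAt E x).open_target.mem_nhds (mem_chart_target E x)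
    have ha := ((α.2 x).contDiffAt hx).differentiableAt (by simp)
    change (extDeriv (c • inChart x α.1) _).compContinuousLinearMap _ = _
    rw [extDeriv_complex_smul c ha]
    rfl

variable (E X) in
/-- Smooth Riemannian metrics on `X`. -/
abbrev Metric [IsManifold 𝓘(ℝ, E) ∞ X] :=
  Bundle.ContMDiffRiemannianMetric 𝓘(ℝ, E) ∞ E (fun x : X => TangentSpace 𝓘(ℝ, E) x)

/-- The derivative of the inverse of the chart at `x₀`. -/
def symmDeriv (x₀ : X) (y : E) : E →L[ℝ] E := mfderiv 𝓘(ℝ, E) 𝓘(ℝ, E) (chartAt E x₀).symm y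

/-- The metric read in the chart at `x₀`. -/
def metricInChart
    (inner : ∀ x : X, TangentSpace 𝓘(ℝ, E) x →L[ℝ] TangentSpace 𝓘(ℝ, E) x →L[ℝ] ℝ)
    (x₀ : X) (y : E) : E →L[ℝ] E →L[ℝ] ℝ :=
  (show E →L[ℝ] E →L[ℝ] ℝ from inner ((chartAt E x₀).symm y)).bilinearComp
    (symmDeriv x₀ y) (symmDeriv x₀ y)

theorem metricInChart_eq_inCoordinates [IsManifold 𝓘(ℝ, E) ∞ X]
    (inner : ∀ x : X, TangentSpace 𝓘(ℝ, E) x →L[ℝ] TangentSpace 𝓘(ℝ, E) x →L[ℝ] ℝ)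
    (x₀ : X) {y : E} (hy : y ∈ (chartAt E x₀).target) :
    metricInChart inner x₀ y = ContinuousLinearMap.inCoordinates E (TangentSpace 𝓘(ℝ, E) (M := X)) (E →L[ℝ] ℝ)
      (fun x => TangentSpace 𝓘(ℝ, E) x →L[ℝ] ℝ) x₀ ((chartAt E x₀).symm y) x₀
      ((chartAt E x₀).symm y) (inner ((chartAt E x₀).symm y)) := by
  have hx : (chartAt E x₀).symm y ∈ (chartAt E x₀).source := (chartAt E x₀).map_target hy
  ext v w
  have := inCoordinates_apply_eq₂ (𝕜 := ℝ) (F₁ := E) (F₂ := E) (F₃ := ℝ) (E₁ := TangentSpace 𝓘(ℝ, E) (M := X)) (E₂ := TangentSpace 𝓘(ℝ, E) (M := X)) (E₃ := Bundle.Trivial X ℝ)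
    (x₀ := x₀) (x := (chartAt E x₀).symm y) (ϕ := inner ((chartAt E x₀).symm y)) (v := v) (w := w)
    (by simpa using hx) (by simpa using hx) (by simp)
  have h2 (u : E) : (trivializationAt E (TangentSpace 𝓘(ℝ, E)) x₀).symm ((chartAt E x₀).symm y) u
      = symmDeriv x₀ y u := by
    have h3 := DFunLike.congr_fun (TangentBundle.symmL_trivializationAt (I := 𝓘(ℝ, E)) hx) u
    rw [Bundle.Trivialization.symmL_apply _ (by simpa using hx)] at h3
    rw [h3]
    have h4 : symmDeriv x₀ (chartAt E x₀ ((chartAt E x₀).symm y)) u = symmDeriv x₀ y u := by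
      rw [(chartAt E x₀).right_inv hy]
    rw [← h4]
    simp
    rfl
  rw [h2, h2] at this
  refine Eq.trans ?_ this.symm
  simp
  rfl

set_option synthInstance.maxHeartbeats 400000 in
theorem smooth_iff_metricInChart [IsManifold 𝓘(ℝ, E) ∞ X]
    (inner : ∀ x : X, TangentSpace 𝓘(ℝ, E) x →L[ℝ] TangentSpace 𝓘(ℝ, E) x →L[ℝ] ℝ) (x₀ : X)
    {y : E} (hy : y ∈ (chartAt E x₀).target) :
    ContMDiffAt 𝓘(ℝ, E) (𝓘(ℝ, E).prod 𝓘(ℝ, E →L[ℝ] E →L[ℝ] ℝ)) ∞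
      (fun b ↦ Bundle.TotalSpace.mk' (E →L[ℝ] E →L[ℝ] ℝ) b (inner b) : X → Bundle.TotalSpace _
        (fun x : X => TangentSpace 𝓘(ℝ, E) x →L[ℝ] TangentSpace 𝓘(ℝ, E) x →L[ℝ] ℝ))
        ((chartAt E x₀).symm y) ↔
    ContDiffAt ℝ ∞ (metricInChart inner x₀) y := by
  have hx : (chartAt E x₀).symm y ∈ (chartAt E x₀).source := (chartAt E x₀).map_target hy
  have hb : ∀ x ∈ (chartAt E x₀).source, x ∈ (trivializationAt (E →L[ℝ] E →L[ℝ] ℝ)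
    (fun x : X => TangentSpace 𝓘(ℝ, E) x →L[ℝ] TangentSpace 𝓘(ℝ, E) x →L[ℝ] ℝ) x₀).baseSet := by
    intro x hx
    simpa [hom_trivializationAt_baseSet] using hx
  rw [Bundle.Trivialization.contMDiffAt_section_iff (trivializationAt (E →L[ℝ] E →L[ℝ] ℝ)
    (fun x : X => TangentSpace 𝓘(ℝ, E) x →L[ℝ] TangentSpace 𝓘(ℝ, E) x →L[ℝ] ℝ) x₀) (hb _ hx)]
  have key : ∀ z ∈ (chartAt E x₀).target, metricInChart inner x₀ z =
      (trivializationAt (E →L[ℝ] E →L[ℝ] ℝ)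
    (fun x : X => TangentSpace 𝓘(ℝ, E) x →L[ℝ] TangentSpace 𝓘(ℝ, E) x →L[ℝ] ℝ) x₀
      ⟨(chartAt E x₀).symm z, inner ((chartAt E x₀).symm z)⟩).2 := by
    intro z hz
    rw [metricInChart_eq_inCoordinates inner x₀ hz, hom_trivializationAt_apply]
  constructor
  · intro h
    have h1 : ContMDiffAt 𝓘(ℝ, E) 𝓘(ℝ, E) ∞ (chartAt E x₀).symm y :=
      (contMDiffOn_chart_symm (I := 𝓘(ℝ, E)) (x := x₀)).contMDiffAt
        ((chartAt E x₀).open_target.mem_nhds hy)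
    have h2 := (h.comp y h1).contDiffAt
    refine h2.congr_of_eventuallyEq ?_
    filter_upwards [(chartAt E x₀).open_target.mem_nhds hy] with z hz using key z hz
  · intro h
    have h1 : ContMDiffAt 𝓘(ℝ, E) 𝓘(ℝ, E) ∞ (chartAt E x₀) ((chartAt E x₀).symm y) :=
      (contMDiffOn_chart (I := 𝓘(ℝ, E)) (x := x₀)).contMDiffAt
        ((chartAt E x₀).open_source.mem_nhds hx)
    rw [← (chartAt E x₀).right_inv hy] at h
    refine (h.contMDiffAt.comp _ h1).congr_of_eventuallyEq ?_
    filter_upwards [(chartAt E x₀).open_source.mem_nhds hx] with z hz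
    have := key _ ((chartAt E x₀).map_source hz)
    rw [(chartAt E x₀).left_inv hz] at this
    exact this.symm

theorem contDiffAt_metricInChart [IsManifold 𝓘(ℝ, E) ∞ X] (g : Metric E X) (x₀ : X) {y : E}
    (hy : y ∈ (chartAt E x₀).target) : ContDiffAt ℝ ∞ (metricInChart g.inner x₀) y :=
  (smooth_iff_metricInChart g.inner x₀ hy).mp g.contMDiff.contMDiffAt

theorem symmDeriv_eq_fderiv [IsManifold 𝓘(ℝ, E) ∞ X] (x₀ : X) {y : E}
    (hy : y ∈ (chartAt E x₀).target) :
    symmDeriv x₀ y =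
      fderiv ℝ (chartAt E ((chartAt E x₀).symm y) ∘ (chartAt E x₀).symm) y := by
  have h1 := mfderiv_symm_trans x₀ ((chartAt E x₀).symm y) hy (mem_chart_source E _)
  have h2 := mfderiv_symm_self (E := E) ((chartAt E x₀).symm y)
  rw [h2] at h1
  exact h1

theorem exists_complex_fderiv {f f' : E → E} {y : E} (hf : DifferentiableAt ℂ f y)
    (hf' : DifferentiableAt ℂ f' (f y)) (h : f' ∘ f =ᶠ[𝓝 y] id) (h' : f ∘ f' =ᶠ[𝓝 (f y)] id) :
    ∃ T : E ≃ₗ[ℂ] E, ∀ v, fderiv ℝ f y v = T v := by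
  have hy : f' (f y) = y := h.eq_of_nhds
  have h1 : (fderiv ℂ f' (f y)).comp (fderiv ℂ f y) = ContinuousLinearMap.id ℂ E := by
    rw [← fderiv_comp y hf' hf, h.fderiv_eq, fderiv_id]
  have h2 : (fderiv ℂ f y).comp (fderiv ℂ f' (f y)) = ContinuousLinearMap.id ℂ E := by
    have := fderiv_comp (f y) (hy.symm ▸ hf) hf'
    rw [h'.fderiv_eq, fderiv_id, hy] at this
    exact this.symm
  refine ⟨LinearEquiv.ofLinearMap (fderiv ℂ f y : E →ₗ[ℂ] E) (fderiv ℂ f' (f y) : E →ₗ[ℂ] E) ?_ ?_,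
    fun v => ?_⟩
  · ext v; exact DFunLike.congr_fun h2 v
  · ext v; exact DFunLike.congr_fun h1 v
  · rw [hf.fderiv_restrictScalars ℝ]
    rfl

theorem exists_symmDeriv_eq [IsManifold 𝓘(ℂ, E) ω X] (x₀ : X) {y : E}
    (hy : y ∈ (chartAt E x₀).target) : ∃ T : E ≃ₗ[ℂ] E, ∀ v, symmDeriv x₀ y v = T v := by
  rw [symmDeriv_eq_fderiv x₀ hy]
  set x := (chartAt E x₀).symm y with hx
  have hxs := mem_chart_source E x
  have hx0 : x ∈ (chartAt E x₀).source := (chartAt E x₀).map_target hy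
  have e1 : (chartAt E x).symm (chartAt E x x) = x := (chartAt E x).left_inv hxs
  refine exists_complex_fderiv (f' := chartAt E x₀ ∘ (chartAt E x).symm)
    ((transition_contDiffAt (𝕜 := ℂ) (n := ω) x₀ x hy hxs).differentiableAt (by simp))
    ((transition_contDiffAt (𝕜 := ℂ) (n := ω) x x₀ ((chartAt E x).map_source hxs)
      (by rw [e1]; exact hx0)).differentiableAt (by simp)) ?_ ?_
  · have : (chartAt E x₀).symm ⁻¹' (chartAt E x).source ∩ (chartAt E x₀).target ∈ 𝓝 y :=
      Filter.inter_mem (((chartAt E x₀).continuousAt_symm hy).preimage_mem_nhds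
        ((chartAt E x).open_source.mem_nhds hxs)) ((chartAt E x₀).open_target.mem_nhds hy)
    filter_upwards [this] with z hz
    simp [(chartAt E x).left_inv hz.1, (chartAt E x₀).right_inv hz.2]
  · have hy' := (chartAt E x).map_source hxs
    have : (chartAt E x).symm ⁻¹' (chartAt E x₀).source ∩ (chartAt E x).target ∈
        𝓝 (chartAt E x x) :=
      Filter.inter_mem (((chartAt E x).continuousAt_symm hy').preimage_mem_nhds
        ((chartAt E x₀).open_source.mem_nhds (by rw [e1]; exact hx0)))
        ((chartAt E x).open_target.mem_nhds hy')
    filter_upwards [this] with z hz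
    simp [(chartAt E x₀).left_inv hz.1, (chartAt E x).right_inv hz.2]

section Star

variable [FiniteDimensional ℂ E]

def starForm [IsManifold 𝓘(ℝ, E) ∞ X] (g : Metric E X) (m : ℕ) (α : Form E X k) : Form E X m :=
  fun x => pointStar (V := E) (realBasis E) (g.inner x) k m (α x)

theorem inChart_starForm [IsManifold 𝓘(ℂ, E) ω X] (g : Metric E X) (m : ℕ) (α : Form E X k)
    (x₀ : X) {y : E} (hy : y ∈ (chartAt E x₀).target) :
    inChart x₀ (starForm g m α) y =
      pointStar (realBasis E) (metricInChart g.inner x₀ y) k m (inChart x₀ α y) := by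
  obtain ⟨T, hT⟩ := exists_symmDeriv_eq x₀ hy
  exact (pointStar_comp (realBasis E) T (symmDeriv x₀ y) hT (g.inner ((chartAt E x₀).symm y))
    (metricInChart g.inner x₀ y) (fun v w => rfl) k m (α ((chartAt E x₀).symm y))).symm

theorem IsSmoothForm.starForm [IsManifold 𝓘(ℂ, E) ω X] (g : Metric E X) (m : ℕ) {α : Form E X k}
    (hα : IsSmoothForm α) : IsSmoothForm (starForm g m α) := by
  intro x₀ y hy
  obtain ⟨T, hT⟩ := exists_symmDeriv_eq x₀ hy
  have hn := (chartAt E x₀).open_target.mem_nhds hy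
  have h := contDiffAt_pointStar (realBasis E) k m (contDiffAt_metricInChart g x₀ hy)
    ((hα x₀).contDiffAt hn) (fun v hv => g.pos _ (symmDeriv x₀ y v) (by
      rw [hT]
      exact T.map_ne_zero_iff.mpr hv))
  refine (h.congr_of_eventuallyEq ?_).contDiffWithinAt
  filter_upwards [hn] with z hz using inChart_starForm g m α x₀ hz

/-- The Hodge star on smooth forms. -/
def star [IsManifold 𝓘(ℂ, E) ω X] (g : Metric E X) (k m : ℕ) :
    SmoothForm E X k →ₗ[ℂ] SmoothForm E X m where
  toFun α := ⟨starForm g m α.1, α.2.starForm g m⟩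
  map_add' _ _ := Subtype.ext (funext fun _ => pointStar_add _ _ _ _ _ _)
  map_smul' _ _ := Subtype.ext (funext fun _ => pointStar_smul _ _ _ _ _ _)

/-- The codifferential: `δ = - ⋆ d ⋆`, as the real dimension `finrank ℂ E * 2` is even. -/
def codiff [IsManifold 𝓘(ℂ, E) ω X] (g : Metric E X) (k : ℕ) :
    SmoothForm E X (k + 1) →ₗ[ℂ] SmoothForm E X k :=
  -(star g (finrank ℂ E * 2 - (k + 1) + 1) k ∘ₗ d ∘ₗ
    star g (k + 1) (finrank ℂ E * 2 - (k + 1)))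

/-- The Hodge Laplacian `d δ + δ d` on smooth `k`-forms. -/
def laplacian [IsManifold 𝓘(ℂ, E) ω X] (g : Metric E X) :
    (k : ℕ) → Module.End ℂ (SmoothForm E X k)
  | 0 => codiff g 0 ∘ₗ d
  | k + 1 => d ∘ₗ codiff g k + codiff g (k + 1) ∘ₗ d

end Star

section Quotient

/-- `G` acts on the complex manifold `X` by holomorphic maps. -/
class HolomorphicSMul (E : Type*) [NormedAddCommGroup E] [NormedSpace ℂ E] (G X : Type*) [Group G]
    [TopologicalSpace X] [ChartedSpace E X] [MulAction G X] : Prop where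
  contMDiff_smul (a : G) : ContMDiff 𝓘(ℂ, E) 𝓘(ℂ, E) ω fun x : X => a • x

instance {G : Type*} [Group G] [MulAction G X] [HolomorphicSMul E G X] (Γ : Subgroup G) :
    HolomorphicSMul E Γ X where
  contMDiff_smul a := HolomorphicSMul.contMDiff_smul (a : G)

instance {G : Type*} [Group G] [MulAction G X] [ContinuousConstSMul G X] (Γ : Subgroup G) :
    ContinuousConstSMul Γ X where
  continuous_const_smul a := continuous_const_smul (a : G)

variable (Γ : Type*) [Group Γ] [MulAction Γ X]

/-- The projection `X → Γ \ X`. -/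
def quotientMap (x : X) : MulAction.orbitRel.Quotient Γ X := Quotient.mk _ x

theorem exists_smul_eq {x y : X} (h : quotientMap Γ x = quotientMap Γ y) : ∃ γ : Γ, γ • x = y := by
  have h1 : (MulAction.orbitRel Γ X) y x := Quotient.exact h.symm
  exact MulAction.orbitRel_apply.mp h1

theorem quotientMap_smul (γ : Γ) (x : X) : quotientMap Γ (γ • x) = quotientMap Γ x :=
  Quotient.sound ⟨γ, rfl⟩

variable [ContinuousConstSMul Γ X]

theorem continuous_quotientMap : Continuous (quotientMap Γ : X → _) := continuous_quotient_mk'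

variable {Γ} in
theorem section_eventually (s : OpenPartialHomeomorph (MulAction.orbitRel.Quotient Γ X) X)
    (hs : ⇑s.symm = quotientMap Γ) {x : X} (hx : quotientMap Γ x ∈ s.source) :
    ∃ γ : Γ, γ • x = s (quotientMap Γ x) ∧ ∀ᶠ z in 𝓝 x, s (quotientMap Γ z) = γ • z := by
  have h1 : quotientMap Γ (s (quotientMap Γ x)) = quotientMap Γ x := by
    rw [← hs]; exact hs ▸ s.left_inv hx
  obtain ⟨γ, hγ⟩ := exists_smul_eq Γ h1.symm
  refine ⟨γ, hγ, ?_⟩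
  have h2 : (fun z => γ • z) ⁻¹' s.target ∈ 𝓝 x :=
    (continuous_const_smul γ).continuousAt.preimage_mem_nhds
      (s.open_target.mem_nhds (hγ ▸ s.map_source hx))
  filter_upwards [h2] with z hz
  have := s.right_inv hz
  rwa [hs, quotientMap_smul] at this

variable [Finite Γ] [IsCancelSMul Γ X] [T2Space X] [LocallyCompactSpace X]

theorem isLocalHomeomorph_quotientMap : IsLocalHomeomorph (quotientMap Γ : X → _) :=
  (isQuotientCoveringMap_quotientMk_of_properlyDiscontinuousSMul
    (E := X) (G := Γ)).isCoveringMap.isLocalHomeomorph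

variable {Γ}

/-- The representative of an orbit that the atlas of the quotient is built on. -/
def rep (q : MulAction.orbitRel.Quotient Γ X) : X :=
  (Quotient.mk_surjective (s := MulAction.orbitRel Γ X)).hasRightInverse.choose q

/-- The local section of `X → Γ \ X` at `q` that the atlas of the quotient is built on. -/
def sectionAt (q : MulAction.orbitRel.Quotient Γ X) :
    OpenPartialHomeomorph (MulAction.orbitRel.Quotient Γ X) X :=
  (isLocalHomeomorph_quotientMap Γ).localInverseAt (rep q)

theorem quotientMap_rep (q : MulAction.orbitRel.Quotient Γ X) : quotientMap Γ (rep q) = q :=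
  (Quotient.mk_surjective (s := MulAction.orbitRel Γ X)).hasRightInverse.choose_spec q

theorem sectionAt_symm (q : MulAction.orbitRel.Quotient Γ X) :
    ⇑(sectionAt q).symm = quotientMap Γ :=
  IsLocalHomeomorph.localInverseAt_symm _ _

theorem mem_sectionAt_source (q : MulAction.orbitRel.Quotient Γ X) : q ∈ (sectionAt q).source := by
  have := (isLocalHomeomorph_quotientMap Γ).apply_self_mem_localInverseAt_source (x := rep q)
  rwa [quotientMap_rep] at this

theorem sectionAt_self (q : MulAction.orbitRel.Quotient Γ X) : sectionAt q q = rep q := by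
  have := (isLocalHomeomorph_quotientMap Γ).localInverseAt_apply_self (x := rep q)
  rwa [quotientMap_rep] at this

theorem chartAt_quotient (q : MulAction.orbitRel.Quotient Γ X) :
    chartAt E q = (sectionAt q).trans (chartAt E (rep q)) := rfl

/-- The quotient of a complex manifold by a free holomorphic action of a finite group is a complex
manifold. -/
instance isManifold_quotient [IsManifold 𝓘(ℂ, E) ω X] [HolomorphicSMul E Γ X] :
    IsManifold 𝓘(ℂ, E) ω (MulAction.orbitRel.Quotient Γ X) := by
  refine isManifold_of_contDiffOn _ _ _ ?_
  rintro _ _ ⟨q₁, rfl⟩ ⟨q₂, rfl⟩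
  change ContDiffOn ℂ ω (((sectionAt q₁).trans (chartAt E (rep q₁))).symm.trans
    ((sectionAt q₂).trans (chartAt E (rep q₂))))
    ((((sectionAt q₁).trans (chartAt E (rep q₁))).symm.trans
    ((sectionAt q₂).trans (chartAt E (rep q₂)))).source ∩ Set.range id)
  rintro y ⟨hy, -⟩
  simp only [OpenPartialHomeomorph.trans_source, OpenPartialHomeomorph.symm_source,
    OpenPartialHomeomorph.trans_target, Set.mem_inter_iff, Set.mem_preimage,
    OpenPartialHomeomorph.coe_trans_symm, Function.comp_apply, sectionAt_symm] at hy
  obtain ⟨⟨hy1, hy2⟩, hy3, hy4⟩ := hy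
  obtain ⟨γ, hγ, hev⟩ := section_eventually (sectionAt q₂) (sectionAt_symm q₂) hy3
  rw [← hγ] at hy4
  have h1 : ContMDiffAt 𝓘(ℂ, E) 𝓘(ℂ, E) ω (chartAt E (rep q₁)).symm y :=
    (contMDiffOn_chart_symm (I := 𝓘(ℂ, E)) (x := rep q₁)).contMDiffAt
      ((chartAt E (rep q₁)).open_target.mem_nhds hy1)
  have h2 := (HolomorphicSMul.contMDiff_smul (E := E) (X := X) γ).contMDiffAt
    (x := (chartAt E (rep q₁)).symm y)
  have h3 : ContMDiffAt 𝓘(ℂ, E) 𝓘(ℂ, E) ω (chartAt E (rep q₂))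
    (γ • (chartAt E (rep q₁)).symm y) :=
    (contMDiffOn_chart (I := 𝓘(ℂ, E)) (x := rep q₂)).contMDiffAt
      ((chartAt E (rep q₂)).open_source.mem_nhds hy4)
  have h4 := (h3.comp y (h2.comp y h1)).contDiffAt
  refine (h4.congr_of_eventuallyEq ?_).contDiffWithinAt
  filter_upwards [((chartAt E (rep q₁)).continuousAt_symm hy1).eventually hev] with z hz
  simp [sectionAt_symm, hz]

end Quotient

section QuotientMetric

/-- The action of `G` preserves the metric `g`. -/
def IsIsometricAction [IsManifold 𝓘(ℝ, E) ∞ X] (G : Type*) [Group G] [MulAction G X]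
    (g : Metric E X) : Prop :=
  ∀ (a : G) (x : X) (v w : TangentSpace 𝓘(ℝ, E) x),
    g.inner (a • x) (mfderiv 𝓘(ℝ, E) 𝓘(ℝ, E) (fun z : X => a • z) x v)
      (mfderiv 𝓘(ℝ, E) 𝓘(ℝ, E) (fun z : X => a • z) x w) = g.inner x v w

theorem IsIsometricAction.subgroup [IsManifold 𝓘(ℝ, E) ∞ X] {G : Type*} [Group G] [MulAction G X]
    {g : Metric E X} (h : IsIsometricAction G g) (Γ : Subgroup G) : IsIsometricAction Γ g :=
  fun a => h (a : G)

theorem inner_congr {Y : Type*} [TopologicalSpace Y] [ChartedSpace E Y]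
    (inner : ∀ x : X, TangentSpace 𝓘(ℝ, E) x →L[ℝ] TangentSpace 𝓘(ℝ, E) x →L[ℝ] ℝ)
    {f h : Y → X} {y : Y} (e : f =ᶠ[𝓝 y] h) (v w : TangentSpace 𝓘(ℝ, E) y) :
    inner (f y) (mfderiv 𝓘(ℝ, E) 𝓘(ℝ, E) f y v) (mfderiv 𝓘(ℝ, E) 𝓘(ℝ, E) f y w) =
      inner (h y) (mfderiv 𝓘(ℝ, E) 𝓘(ℝ, E) h y v) (mfderiv 𝓘(ℝ, E) 𝓘(ℝ, E) h y w) := by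
  let inner' : X → E →L[ℝ] E →L[ℝ] ℝ := inner
  have h1 : (mfderiv 𝓘(ℝ, E) 𝓘(ℝ, E) f y : E →L[ℝ] E) = mfderiv 𝓘(ℝ, E) 𝓘(ℝ, E) h y :=
    e.mfderiv_eq
  have h2 : f y = h y := e.eq_of_nhds
  change inner' (f y) ((mfderiv 𝓘(ℝ, E) 𝓘(ℝ, E) f y : E →L[ℝ] E) v)
    ((mfderiv 𝓘(ℝ, E) 𝓘(ℝ, E) f y : E →L[ℝ] E) w) = _
  rw [h1, h2]
  rfl

variable {Γ : Type*} [Group Γ] [MulAction Γ X] [ContinuousConstSMul Γ X] [Finite Γ]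
  [IsCancelSMul Γ X] [T2Space X] [LocallyCompactSpace X] [IsManifold 𝓘(ℂ, E) ω X]
  [HolomorphicSMul E Γ X]

theorem contMDiff_smul_real (γ : Γ) : ContMDiff 𝓘(ℝ, E) 𝓘(ℝ, E) ω fun x : X => γ • x := by
  have h := contMDiff_iff.mp (HolomorphicSMul.contMDiff_smul (E := E) (X := X) γ)
  refine contMDiff_iff.mpr ⟨h.1, fun x y => ?_⟩
  exact (h.2 x y).restrict_scalars ℝ

theorem contMDiff_quotientMap : ContMDiff 𝓘(ℝ, E) 𝓘(ℝ, E) ω (quotientMap Γ : X → _) := by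
  intro x
  rw [contMDiffAt_iff_target]
  refine ⟨(continuous_quotientMap Γ).continuousAt, ?_⟩
  obtain ⟨γ, hγ, hev⟩ := section_eventually (sectionAt (quotientMap Γ x)) (sectionAt_symm _)
    (mem_sectionAt_source (quotientMap Γ x))
  have h3 : ContMDiffAt 𝓘(ℝ, E) 𝓘(ℝ, E) ω (chartAt E (rep (quotientMap Γ x))) (γ • x) := by
    rw [hγ, sectionAt_self]
    exact (contMDiffOn_chart (I := 𝓘(ℝ, E))).contMDiffAt
      ((chartAt E (rep (quotientMap Γ x))).open_source.mem_nhds (mem_chart_source E _))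
  refine (h3.comp x (contMDiff_smul_real (E := E) γ x)).congr_of_eventuallyEq ?_
  filter_upwards [hev] with z hz
  simp [chartAt_quotient, hz]

theorem contMDiffAt_sectionAt (q : MulAction.orbitRel.Quotient Γ X) :
    ContMDiffAt 𝓘(ℝ, E) 𝓘(ℝ, E) ω (sectionAt q) q := by
  have h1 : ContMDiffAt 𝓘(ℝ, E) 𝓘(ℝ, E) ω (chartAt E q) q :=
    (contMDiffOn_chart (I := 𝓘(ℝ, E))).contMDiffAt
      ((chartAt E q).open_source.mem_nhds (mem_chart_source E _))
  have h2 : ContMDiffAt 𝓘(ℝ, E) 𝓘(ℝ, E) ω (chartAt E (rep q)).symm (chartAt E q q) :=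
    (contMDiffOn_chart_symm (I := 𝓘(ℝ, E)) (x := rep q)).contMDiffAt
      ((chartAt E (rep q)).open_target.mem_nhds (by
        have := mem_chart_target E q
        rw [chartAt_quotient] at this
        exact this.1))
  refine (h2.comp q h1).congr_of_eventuallyEq ?_
  filter_upwards [(chartAt E q).open_source.mem_nhds (mem_chart_source E q)] with z hz
  rw [chartAt_quotient] at hz ⊢
  exact ((chartAt E (rep q)).left_inv hz.2).symm

/-- The inner product on `T_q (Γ \ X)`: the pull-back of `g` under a local section of `X → Γ \ X`
at `q`. It does not depend on the section, see `quotientInner_quotientMap`. -/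
def quotientInner (g : Metric E X) (q : MulAction.orbitRel.Quotient Γ X) :
    TangentSpace 𝓘(ℝ, E) q →L[ℝ] TangentSpace 𝓘(ℝ, E) q →L[ℝ] ℝ :=
  (show E →L[ℝ] E →L[ℝ] ℝ from g.inner (sectionAt q q)).bilinearComp
    (show E →L[ℝ] E from mfderiv 𝓘(ℝ, E) 𝓘(ℝ, E) (sectionAt q) q)
    (show E →L[ℝ] E from mfderiv 𝓘(ℝ, E) 𝓘(ℝ, E) (sectionAt q) q)

theorem quotientInner_apply (g : Metric E X) (q : MulAction.orbitRel.Quotient Γ X)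
    (v w : TangentSpace 𝓘(ℝ, E) q) :
    quotientInner g q v w = g.inner (sectionAt q q)
      (mfderiv 𝓘(ℝ, E) 𝓘(ℝ, E) (sectionAt q) q v) (mfderiv 𝓘(ℝ, E) 𝓘(ℝ, E) (sectionAt q) q w) :=
  rfl

/-- The projection `X → Γ \ X` is a local isometry. -/
theorem quotientInner_quotientMap {g : Metric E X} (hg : IsIsometricAction Γ g) (x : X)
    (v w : TangentSpace 𝓘(ℝ, E) x) :
    quotientInner g (quotientMap Γ x) (mfderiv 𝓘(ℝ, E) 𝓘(ℝ, E) (quotientMap Γ) x v)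
      (mfderiv 𝓘(ℝ, E) 𝓘(ℝ, E) (quotientMap Γ) x w) = g.inner x v w := by
  obtain ⟨γ, hγ, hev⟩ := section_eventually (sectionAt (quotientMap Γ x)) (sectionAt_symm _)
    (mem_sectionAt_source (quotientMap Γ x))
  have h1 := inner_congr (E := E) g.inner
    (f := sectionAt (quotientMap Γ x) ∘ quotientMap Γ) (h := fun z => γ • z) (y := x) hev v w
  have h2 := mfderiv_comp x ((contMDiffAt_sectionAt (E := E) (quotientMap Γ x)).mdifferentiableAt
    (by simp)) ((contMDiff_quotientMap (E := E) (Γ := Γ) x).mdifferentiableAt (by simp))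
  rw [h2, hg] at h1
  exact h1

theorem mfderiv_quotientMap_section (q : MulAction.orbitRel.Quotient Γ X) (v : E) :
    (mfderiv 𝓘(ℝ, E) 𝓘(ℝ, E) (quotientMap Γ) (sectionAt q q) : E →L[ℝ] E)
      ((mfderiv 𝓘(ℝ, E) 𝓘(ℝ, E) (sectionAt q) q : E →L[ℝ] E) v) = v := by
  have h2 := mfderiv_comp q ((contMDiff_quotientMap (E := E) (Γ := Γ)
    (sectionAt q q)).mdifferentiableAt (by simp))
    ((contMDiffAt_sectionAt (E := E) q).mdifferentiableAt (by simp))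
  have h3 : quotientMap Γ ∘ sectionAt q =ᶠ[𝓝 q] id := by
    filter_upwards [(sectionAt q).open_source.mem_nhds (mem_sectionAt_source q)] with z hz
    have := (sectionAt q).left_inv hz
    rwa [sectionAt_symm] at this
  have h4 : (mfderiv 𝓘(ℝ, E) 𝓘(ℝ, E) (quotientMap Γ ∘ sectionAt q) q : E →L[ℝ] E) =
    mfderiv 𝓘(ℝ, E) 𝓘(ℝ, E) (id : MulAction.orbitRel.Quotient Γ X → _) q := h3.mfderiv_eq
  have h5 : (mfderiv 𝓘(ℝ, E) 𝓘(ℝ, E) (id : MulAction.orbitRel.Quotient Γ X → _) q : E →L[ℝ] E) =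
    ContinuousLinearMap.id ℝ E := mfderiv_id
  rw [h5] at h4
  have h6 := DFunLike.congr_fun (h2.symm.trans h4) v
  exact h6

theorem mfderiv_section_ne_zero (q : MulAction.orbitRel.Quotient Γ X)
    (v : TangentSpace 𝓘(ℝ, E) q) (hv : v ≠ 0) :
    mfderiv 𝓘(ℝ, E) 𝓘(ℝ, E) (sectionAt q) q v ≠ 0 := by
  intro h
  have := mfderiv_quotientMap_section (E := E) q v
  change (mfderiv 𝓘(ℝ, E) 𝓘(ℝ, E) (quotientMap Γ) (sectionAt q q) : E →L[ℝ] E)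
      (mfderiv 𝓘(ℝ, E) 𝓘(ℝ, E) (sectionAt q) q v) = v at this
  rw [h] at this
  exact hv (this.symm.trans (map_zero
    (mfderiv 𝓘(ℝ, E) 𝓘(ℝ, E) (quotientMap Γ) (sectionAt q q) : E →L[ℝ] E)))

theorem metricInChart_quotientInner {g : Metric E X} (hg : IsIsometricAction Γ g)
    (q : MulAction.orbitRel.Quotient Γ X) {y : E} (hy : y ∈ (chartAt E q).target) :
    metricInChart (quotientInner g) q y = metricInChart g.inner (rep q) y := by
  have hy' : y ∈ (chartAt E (rep q)).target := by
    rw [chartAt_quotient] at hy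
    exact hy.1
  have e1 : ⇑(chartAt E q).symm = quotientMap Γ ∘ (chartAt E (rep q)).symm := by
    rw [chartAt_quotient, OpenPartialHomeomorph.coe_trans_symm, sectionAt_symm]
  have h2 := mfderiv_comp y ((contMDiff_quotientMap (E := E) (Γ := Γ)
    ((chartAt E (rep q)).symm y)).mdifferentiableAt (by simp))
    (mdifferentiableAt_atlas_symm (chart_mem_atlas E (rep q)) hy')
  ext v w
  have h3 := quotientInner_quotientMap hg ((chartAt E (rep q)).symm y)
    (symmDeriv (rep q) y v) (symmDeriv (rep q) y w)
  refine Eq.trans ?_ h3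
  have h4 := inner_congr (quotientInner g) (f := (chartAt E q).symm) (y := y)
    (h := quotientMap Γ ∘ (chartAt E (rep q)).symm) (by rw [e1]) v w
  rw [h2] at h4
  exact h4

theorem contMDiff_quotientInner {g : Metric E X} (hg : IsIsometricAction Γ g) :
    ContMDiff 𝓘(ℝ, E) (𝓘(ℝ, E).prod 𝓘(ℝ, E →L[ℝ] E →L[ℝ] ℝ)) ∞
      (fun q ↦ Bundle.TotalSpace.mk' (E →L[ℝ] E →L[ℝ] ℝ) q (quotientInner g q) :
        MulAction.orbitRel.Quotient Γ X → Bundle.TotalSpace _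
        (fun q : MulAction.orbitRel.Quotient Γ X =>
          TangentSpace 𝓘(ℝ, E) q →L[ℝ] TangentSpace 𝓘(ℝ, E) q →L[ℝ] ℝ)) := by
  intro q
  have hy := mem_chart_target E q
  have hy' : chartAt E q q ∈ (chartAt E (rep q)).target := by
    rw [chartAt_quotient] at hy
    exact hy.1
  have h1 : ContDiffAt ℝ ∞ (metricInChart (quotientInner g) q) (chartAt E q q) := by
    refine (contDiffAt_metricInChart g (rep q) hy').congr_of_eventuallyEq ?_
    filter_upwards [(chartAt E q).open_target.mem_nhds hy] with z hz
      using metricInChart_quotientInner hg q hz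
  have h := (smooth_iff_metricInChart (quotientInner g) q hy).mpr h1
  rwa [(chartAt E q).left_inv (mem_chart_source E q)] at h

theorem isVonNBounded_quotientInner (g : Metric E X) (q : MulAction.orbitRel.Quotient Γ X) :
    Bornology.IsVonNBounded ℝ {v : TangentSpace 𝓘(ℝ, E) q | quotientInner g q v v < 1} := by
  let L : E →L[ℝ] E := mfderiv 𝓘(ℝ, E) 𝓘(ℝ, E) (quotientMap Γ) (sectionAt q q)
  have h : Bornology.IsVonNBounded ℝ {v : E | g.inner (sectionAt q q) v v < 1} :=
    g.isVonNBounded (sectionAt q q)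
  have h2 : Bornology.IsVonNBounded ℝ (L '' {v : E | g.inner (sectionAt q q) v v < 1}) := h.image L
  refine h2.subset ?_
  intro v hv
  exact ⟨_, hv, mfderiv_quotientMap_section (E := E) q v⟩

theorem quotientInner_symm (g : Metric E X) (q : MulAction.orbitRel.Quotient Γ X)
    (v w : TangentSpace 𝓘(ℝ, E) q) : quotientInner g q v w = quotientInner g q w v := by
  rw [quotientInner_apply, quotientInner_apply]
  exact g.symm _ _ _

theorem quotientInner_pos (g : Metric E X) (q : MulAction.orbitRel.Quotient Γ X)
    (v : TangentSpace 𝓘(ℝ, E) q) (hv : v ≠ 0) : 0 < quotientInner g q v v := by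
  rw [quotientInner_apply]
  exact g.pos _ _ (mfderiv_section_ne_zero q v hv)

/-- The metric on `Γ \ X` for which the projection `X → Γ \ X` is a local isometry. -/
def quotientMetric (g : Metric E X) (hg : IsIsometricAction Γ g) :
    Metric E (MulAction.orbitRel.Quotient Γ X) where
  inner := quotientInner g
  symm := quotientInner_symm g
  pos := quotientInner_pos g
  isVonNBounded := isVonNBounded_quotientInner g
  contMDiff := contMDiff_quotientInner hg

end QuotientMetric

section Types

/-- The alternating forms of type `(p, q)` on the complex vector space `V`: the span of
`a₁ ∧ ⋯ ∧ a_p ∧ b₁ ∧ ⋯ ∧ b_q` with `a_i` complex linear and `b_j` conjugate linear. -/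
def typePQ (V : Type*) [NormedAddCommGroup V] [NormedSpace ℂ V] (p q : ℕ) :
    Submodule ℂ (V [⋀^Fin (p + q)]→L[ℝ] ℂ) :=
  Submodule.span ℂ {ψ | ∃ (a : Fin p → V →ₗ[ℂ] ℂ) (b : Fin q → V →ₛₗ[starRingEnd ℂ] ℂ),
    ∀ v : Fin (p + q) → V, ψ v = (Matrix.of fun i j =>
      Fin.addCases (motive := fun _ => ℂ) (fun r => a r (v j)) (fun s => b s (v j)) i).det}

variable (E X) in
/-- The smooth complex forms of type `(p, q)`. The tangent space at `x` is the model space `E`, in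
the holomorphic chart at `x`. -/
def formsPQ (p q : ℕ) : Submodule ℂ (SmoothForm E X (p + q)) where
  carrier := {α | ∀ x, α.1 x ∈ typePQ E p q}
  zero_mem' := fun _ => (typePQ E p q).zero_mem
  add_mem' := fun ha hb x => (typePQ E p q).add_mem (ha x) (hb x)
  smul_mem' := fun c _ ha x => (typePQ E p q).smul_mem c (ha x)

/-- The complex structure on the tangent spaces. -/
def complexStructure (x : X) : TangentSpace 𝓘(ℝ, E) x →L[ℝ] TangentSpace 𝓘(ℝ, E) x :=
  show E →L[ℝ] E from Complex.I • ContinuousLinearMap.id ℝ E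

/-- `g` is Hermitian and its fundamental form `ω(v, w) = g(I v, w)` is closed. -/
structure IsKahler [IsManifold 𝓘(ℝ, E) ∞ X] (g : Metric E X) : Prop where
  hermitian (x : X) (v w : TangentSpace 𝓘(ℝ, E) x) :
    g.inner x (complexStructure x v) (complexStructure x w) = g.inner x v w
  closed : ∃ η : SmoothForm E X 2, (∀ (x : X) (v w : TangentSpace 𝓘(ℝ, E) x),
    η.1 x ![v, w] = (g.inner x (complexStructure x v) w : ℂ)) ∧ d η = 0

variable [FiniteDimensional ℂ E]

/-- The `μ`-eigenspace of the Hodge Laplacian on forms of type `(p, q)`. -/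
def eigenformsPQ [IsManifold 𝓘(ℂ, E) ω X] (g : Metric E X) (p q : ℕ) (μ : ℂ) :
    Submodule ℂ (SmoothForm E X (p + q)) :=
  (laplacian g (p + q)).eigenspace μ ⊓ formsPQ E X p q

/-- Every complex number has the same multiplicity as an eigenvalue of the two Hodge Laplacians on
forms of type `(p, q)`. -/
def IsospectralPQ.{u, v} {E : Type u} [NormedAddCommGroup E] [NormedSpace ℂ E] [FiniteDimensional ℂ E]
    {X₁ X₂ : Type v} [TopologicalSpace X₁] [ChartedSpace E X₁] [IsManifold 𝓘(ℂ, E) ω X₁]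
    [TopologicalSpace X₂] [ChartedSpace E X₂] [IsManifold 𝓘(ℂ, E) ω X₂]
    (g₁ : Metric E X₁) (g₂ : Metric E X₂) (p q : ℕ) : Prop :=
  ∀ μ : ℂ, Module.rank ℂ (eigenformsPQ g₁ p q μ) = Module.rank ℂ (eigenformsPQ g₂ p q μ)

end Types

/-- Every conjugacy class of `G` meets `Γ₁` and `Γ₂` in the same number of elements. -/
def AlmostConjugate {G : Type*} [Group G] (Γ₁ Γ₂ : Subgroup G) : Prop :=
  ∀ c : ConjClasses G, (c.carrier ∩ Γ₁).ncard = (c.carrier ∩ Γ₂).ncard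

end Forms
end KahlerQuotient
end

noncomputable section
namespace KahlerQuotient

/-! ### Invariants of almost conjugate subgroups in representations of a finite group. -/

section AlmostConjugate

variable {k G : Type*} [Field k] [Group G]

/-! This is Sunada's argument. Let `V` be the space of `μ`-eigenforms of type `(p, q)` on `X`. The
group `G` acts on it by pull-back, and pull-back along `X → Γ \ X` identifies the corresponding
space on `Γ \ X` with the invariants `V^Γ` (`rank_eigenformsPQ_quotientMetric`). So it suffices that
`V^Γ₁` and `V^Γ₂` have the same dimension, which is pure representation theory.

For finite-dimensional `V`, `dim V^Γ` is the average over `Γ` of the character of `V`. A character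
is a class function on `G`, so its sum over `Γ` depends only on how many elements of each conjugacy
class lie in `Γ` (`AlmostConjugate.finrank_invariants_eq`). Finite-dimensionality of the
eigenspaces, an elliptic result, is avoided: by Maschke's theorem any `k[G]`-module is a direct sum
of simple ones, these are finite-dimensional, and taking invariants commutes with direct sums. The
dimensions then agree as cardinals (`AlmostConjugate.rank_invariants_eq`).

The geometric half rests on naturality under holomorphic maps preserving the metrics, which covers
both the elements of `G` and the quotient maps. Such a map has a complex linear isomorphism as
derivative (`IsHolomorphicIsometry.exists_mfderiv_eq`). It therefore preserves the orientation,
hence commutes with the Hodge star, and preserves types. Since pull-back also commutes with `d`, it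
commutes with the Laplacian. Finally, a `Γ`-invariant form descends along the local sections of the
covering `X → Γ \ X` (`range_pullback_quotientMap`). -/

theorem sum_eq_sum_conjClasses (f : G → k) (F : ConjClasses G → k)
    (hF : ∀ g, F (ConjClasses.mk g) = f g) (Γ : Subgroup G) [Fintype Γ] [Fintype (ConjClasses G)] :
    ∑ γ : Γ, f γ = ∑ c : ConjClasses G, (c.carrier ∩ Γ).ncard • F c := by
  classical
  rw [← Finset.sum_fiberwise Finset.univ (fun γ : Γ => ConjClasses.mk (γ : G))]
  refine Finset.sum_congr rfl fun c _ => ?_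
  have h : ∀ γ ∈ Finset.univ.filter (fun γ : Γ => ConjClasses.mk (γ : G) = c), f γ = F c := by
    intro γ hγ
    rw [← hF, (Finset.mem_filter.mp hγ).2]
  rw [Finset.sum_congr rfl h, Finset.sum_const]
  congr 1
  rw [← Set.ncard_coe_finset, ← Set.ncard_image_of_injective _ Subtype.val_injective]
  congr 1
  ext g
  simp only [Set.mem_image, Finset.coe_filter, Finset.mem_univ, true_and, Set.mem_ofPred_eq,
    Set.mem_inter_iff, SetLike.mem_coe, ConjClasses.mem_carrier_iff_mk_eq]
  constructor
  · rintro ⟨γ, h1, rfl⟩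
    exact ⟨h1, γ.2⟩
  · rintro ⟨h1, h2⟩
    exact ⟨⟨g, h2⟩, h1, rfl⟩

/-- The vectors of a `k[G]`-module that are fixed by the subgroup `Γ`. -/
def fixedVectors (k : Type*) {G : Type*} [Field k] [Group G] (Γ : Subgroup G) (M : Type*)
    [AddCommGroup M] [Module k M] [Module (MonoidAlgebra k G) M]
    [IsScalarTower k (MonoidAlgebra k G) M] : Submodule k M where
  carrier := {v | ∀ γ ∈ Γ, MonoidAlgebra.of k G γ • v = v}
  zero_mem' := fun _ _ => smul_zero _
  add_mem' := fun ha hb γ hγ => by rw [smul_add, ha γ hγ, hb γ hγ]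
  smul_mem' := fun c v hv γ hγ => by
    rw [← algebraMap_smul (MonoidAlgebra k G) c v, ← mul_smul, ← Algebra.commutes, mul_smul,
      hv γ hγ]

/-- The group acts on each summand separately, so a vector of the direct sum is fixed exactly when
all its components are. -/
theorem rank_fixedVectors_dfinsupp (Γ : Subgroup G) {ι : Type*} (N : ι → Type*)
    [∀ i, AddCommGroup (N i)] [∀ i, Module k (N i)] [∀ i, Module (MonoidAlgebra k G) (N i)]
    [∀ i, IsScalarTower k (MonoidAlgebra k G) (N i)] :
    Module.rank k (fixedVectors k Γ (Π₀ i, N i)) =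
      Cardinal.sum fun i => Module.rank k (fixedVectors k Γ (N i)) := by
  classical
  let L : (Π₀ i, fixedVectors k Γ (N i)) →ₗ[k] Π₀ i, N i :=
    DFinsupp.mapRange.linearMap fun i => (fixedVectors k Γ (N i)).subtype
  have hL : Function.Injective L := (DFinsupp.mapRange_injective _ (fun _ => rfl)).mpr
    fun i => Subtype.val_injective
  have hr : LinearMap.range L = fixedVectors k Γ (Π₀ i, N i) := by
    ext f
    constructor
    · rintro ⟨f, rfl⟩ γ hγ
      ext i
      exact (f i).2 γ hγ
    · intro hf
      have hi (i : ι) : f i ∈ fixedVectors k Γ (N i) := fun γ hγ => DFunLike.congr_fun (hf γ hγ) i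
      -- `mapRange` needs a map on all of `N i` sending zero to zero, hence the default value `0`;
      -- it is never taken on the components of `f`, which are fixed by `hi`.
      refine ⟨f.mapRange (fun i x => if hx : x ∈ fixedVectors k Γ (N i) then ⟨x, hx⟩ else 0)
        (fun i => by simp), ?_⟩
      ext i
      simp [L, hi]
  rw [← hr, ← (LinearEquiv.ofInjective L hL).rank_eq]
  exact rank_directSum k _

variable [Finite G]

theorem AlmostConjugate.sum_eq {Γ₁ Γ₂ : Subgroup G} (h : AlmostConjugate Γ₁ Γ₂)
    [Fintype Γ₁] [Fintype Γ₂] (f : G → k) (hf : ∀ a b, f (b * a * b⁻¹) = f a) :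
    ∑ γ : Γ₁, f γ = ∑ γ : Γ₂, f γ := by
  classical
  have := Fintype.ofFinite (ConjClasses G)
  let F : ConjClasses G → k := Quotient.lift f fun a b hab => by
    obtain ⟨c, rfl⟩ := isConj_iff.mp hab
    exact (hf a c).symm
  rw [sum_eq_sum_conjClasses f F (fun _ => rfl), sum_eq_sum_conjClasses f F (fun _ => rfl)]
  exact Finset.sum_congr rfl fun c _ => by rw [h c]

/-- The constant function `1` is a class function; taking its values in `ℚ` loses no information
about the count. -/
theorem AlmostConjugate.card_eq {Γ₁ Γ₂ : Subgroup G} (h : AlmostConjugate Γ₁ Γ₂) :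
    Nat.card Γ₁ = Nat.card Γ₂ := by
  have := Fintype.ofFinite Γ₁
  have := Fintype.ofFinite Γ₂
  have := h.sum_eq (k := ℚ) (fun _ => 1) (fun _ _ => rfl)
  simpa using this

variable [CharZero k]

/-- Averaging over `Γ` is a projection onto the invariants, so its trace is their dimension. The
trace is a normalised sum of values of the character of the whole group `G`, a class function on
`G`. Characteristic zero serves to divide by the order of `Γ` and to read off a natural number from
its image in `k`. -/
theorem AlmostConjugate.finrank_invariants_eq {Γ₁ Γ₂ : Subgroup G} (h : AlmostConjugate Γ₁ Γ₂)
    {V : Type*} [AddCommGroup V] [Module k V] [FiniteDimensional k V] (ρ : Representation k G V) :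
    finrank k (Representation.invariants (ρ.comp Γ₁.subtype)) =
      finrank k (Representation.invariants (ρ.comp Γ₂.subtype)) := by
  classical
  have := Fintype.ofFinite Γ₁
  have := Fintype.ofFinite Γ₂
  have : Invertible (Nat.card Γ₁ : k) := invertibleOfNonzero (by simp)
  have : Invertible (Nat.card Γ₂ : k) := invertibleOfNonzero (by simp)
  have h1 := Representation.card_inv_mul_sum_char_eq_finrank (ρ.comp Γ₁.subtype)
  have h2 := Representation.card_inv_mul_sum_char_eq_finrank (ρ.comp Γ₂.subtype)
  have h3 : ∑ γ : Γ₁, ρ.character γ = ∑ γ : Γ₂, ρ.character γ :=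
    h.sum_eq _ fun a b => ρ.char_conj a b
  have h4 : (finrank k (Representation.invariants (ρ.comp Γ₁.subtype)) : k) =
      finrank k (Representation.invariants (ρ.comp Γ₂.subtype)) := by
    rw [← h1, ← h2, h.card_eq]
    exact congrArg _ h3
  exact_mod_cast h4

variable {M : Type*} [AddCommGroup M] [Module k M] [Module (MonoidAlgebra k G) M]
    [IsScalarTower k (MonoidAlgebra k G) M]

theorem AlmostConjugate.rank_fixedVectors_eq_of_simple {Γ₁ Γ₂ : Subgroup G}
    (h : AlmostConjugate Γ₁ Γ₂) [IsSimpleModule (MonoidAlgebra k G) M] :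
    Module.rank k (fixedVectors k Γ₁ M) = Module.rank k (fixedVectors k Γ₂ M) := by
  -- A simple module is generated by one element, and `k[G]` has finite dimension because `G` is
  -- finite.
  have : Module.Finite k M := Module.Finite.trans (MonoidAlgebra k G) M
  have e (Γ : Subgroup G) : fixedVectors k Γ M = Representation.invariants
      ((Representation.ofModule' (k := k) (G := G) M).comp Γ.subtype) := by
    ext v
    exact ⟨fun hv γ => hv γ γ.2, fun hv γ hγ => hv ⟨γ, hγ⟩⟩
  rw [e, e, ← finrank_eq_rank, ← finrank_eq_rank, h.finrank_invariants_eq]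

/-- The module is decomposed under `G`, not under the subgroups, so one and the same decomposition
computes both sides summand by summand. A sum of cardinals makes this work in any dimension. -/
theorem AlmostConjugate.rank_fixedVectors_eq {Γ₁ Γ₂ : Subgroup G}
    (h : AlmostConjugate Γ₁ Γ₂) :
    Module.rank k (fixedVectors k Γ₁ M) = Module.rank k (fixedVectors k Γ₂ M) := by
  -- The hypothesis of Maschke's theorem, from which semisimplicity is inferred.
  have : NeZero (Nat.card G : k) := ⟨by simp [Nat.card_pos.ne']⟩
  obtain ⟨s, e, -, hs⟩ := IsSemisimpleModule.exists_linearEquiv_dfinsupp (MonoidAlgebra k G) M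
  let L : M ≃ₗ[k] Π₀ m : s, m.1 := e.restrictScalars k
  have key (Γ : Subgroup G) : Module.rank k (fixedVectors k Γ M) =
      Cardinal.sum fun m : s => Module.rank k (fixedVectors k Γ m.1) := by
    have hmap : (fixedVectors k Γ M).map (L : M →ₗ[k] Π₀ m : s, m.1) =
        fixedVectors k Γ (Π₀ m : s, m.1) := by
      ext f
      rw [Submodule.mem_map_equiv]
      change (∀ γ ∈ Γ, MonoidAlgebra.of k G γ • e.symm f = e.symm f) ↔
        ∀ γ ∈ Γ, MonoidAlgebra.of k G γ • f = f
      simp only [← map_smul, e.symm.injective.eq_iff]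
    rw [← rank_fixedVectors_dfinsupp, ← hmap, (L.submoduleMap (fixedVectors k Γ M)).rank_eq]
  rw [key, key]
  congr 1
  ext m
  have := hs m
  exact h.rank_fixedVectors_eq_of_simple

theorem AlmostConjugate.rank_invariants_eq {Γ₁ Γ₂ : Subgroup G} (h : AlmostConjugate Γ₁ Γ₂)
    {V : Type*} [AddCommGroup V] [Module k V] (ρ : Representation k G V) :
    Module.rank k (Representation.invariants (ρ.comp Γ₁.subtype)) =
      Module.rank k (Representation.invariants (ρ.comp Γ₂.subtype)) := by
  have key (Γ : Subgroup G) : Module.rank k (Representation.invariants (ρ.comp Γ.subtype)) =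
      Module.rank k (fixedVectors k Γ ρ.asModule) := by
    have e : (fixedVectors k Γ ρ.asModule).map (ρ.asModuleEquiv : ρ.asModule →ₗ[k] V) =
        Representation.invariants (ρ.comp Γ.subtype) := by
      ext v
      rw [Submodule.mem_map_equiv]
      have h1 (γ : G) : MonoidAlgebra.of k G γ • ρ.asModuleEquiv.symm v = ρ.asModuleEquiv.symm v ↔
          ρ γ v = v := by
        rw [← Representation.asModuleEquiv_symm_map_rho, ρ.asModuleEquiv.symm.injective.eq_iff]
      exact ⟨fun hv γ => (h1 γ).mp (hv γ γ.2), fun hv γ hγ => (h1 γ).mpr (hv ⟨γ, hγ⟩)⟩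
    rw [← e, (ρ.asModuleEquiv.submoduleMap (fixedVectors k Γ ρ.asModule)).rank_eq]
  rw [key, key, h.rank_fixedVectors_eq]

end AlmostConjugate

/-! ### Pull-back of differential forms, its smoothness, and its compatibility with `d`. -/

theorem contDiff_compContinuousLinearMap {V W : Type*} [NormedAddCommGroup V] [NormedSpace ℝ V]
    [FiniteDimensional ℝ V] [NormedAddCommGroup W] [NormedSpace ℝ W] [FiniteDimensional ℝ W]
    {k : ℕ} {n : ℕ∞ω} :
    ContDiff ℝ n fun z : (W [⋀^Fin k]→L[ℝ] ℂ) × (V →L[ℝ] W) =>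
      z.1.compContinuousLinearMap z.2 := by
  let C : (V [⋀^Fin k]→L[ℝ] ℂ) →L[ℝ] ContinuousMultilinearMap ℝ (fun _ : Fin k => V) ℂ :=
    ContinuousAlternatingMap.toContinuousMultilinearMapCLM ℝ
  let C' : (W [⋀^Fin k]→L[ℝ] ℂ) →L[ℝ] ContinuousMultilinearMap ℝ (fun _ : Fin k => W) ℂ :=
    ContinuousAlternatingMap.toContinuousMultilinearMapCLM ℝ
  have hC : LinearMap.ker C.toLinearMap = ⊥ :=
    LinearMap.ker_eq_bot.mpr ContinuousAlternatingMap.toContinuousMultilinearMap_injective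
  -- Smoothness is checked after embedding alternating maps into multilinear maps, where composition
  -- is the diagonal of a multilinear operation. The linear retraction `P`, continuous by
  -- finite-dimensionality, brings the result back.
  obtain ⟨P, hP⟩ := C.toLinearMap.exists_leftInverse_of_injective hC
  have : FiniteDimensional ℝ (ContinuousMultilinearMap ℝ (fun _ : Fin k => V) ℂ) :=
    FiniteDimensional.of_injective
      ContinuousMultilinearMap.toMultilinearMapLinear
      ContinuousMultilinearMap.toMultilinearMap_injective
  have h1 : ContDiff ℝ n fun z : (W [⋀^Fin k]→L[ℝ] ℂ) × (V →L[ℝ] W) =>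
      ContinuousMultilinearMap.compContinuousLinearMapContinuousMultilinear ℝ (fun _ : Fin k => V)
        (fun _ : Fin k => W) ℂ (fun _ => z.2) :=
    (ContinuousMultilinearMap.contDiff _).comp (contDiff_pi.mpr fun _ => contDiff_snd)
  have h2 : ContDiff ℝ n fun z : (W [⋀^Fin k]→L[ℝ] ℂ) × (V →L[ℝ] W) =>
      z.1.toContinuousMultilinearMap :=
    C'.contDiff.comp contDiff_fst
  have h3 := (LinearMap.toContinuousLinearMap P).contDiff (n := n) |>.comp (h1.clm_apply h2)
  convert h3 using 1
  funext z
  exact (DFunLike.congr_fun hP (z.1.compContinuousLinearMap z.2)).symm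

section Pullback

variable {E : Type*} [NormedAddCommGroup E] [NormedSpace ℂ E]
variable {X Y Z : Type*} [TopologicalSpace X] [ChartedSpace E X] [TopologicalSpace Y]
  [ChartedSpace E Y] [TopologicalSpace Z] [ChartedSpace E Z]
variable {k : ℕ}

/-- The pull-back of a form. -/
def pullbackForm (f : X → Y) (α : Form E Y k) : Form E X k := fun x =>
  (α (f x)).compContinuousLinearMap (mfderiv 𝓘(ℝ, E) 𝓘(ℝ, E) f x)

theorem inChart_eq_pullbackForm (x : X) (α : Form E X k) :
    inChart x α = pullbackForm (X := E) (chartAt E x).symm α := rfl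

theorem pullbackForm_congr {f h : X → Y} (α : Form E Y k) {x : X} (e : f =ᶠ[𝓝 x] h) :
    pullbackForm f α x = pullbackForm h α x := by
  -- The tangent spaces are all `E` by definition; forgetting their dependence on the point allows
  -- `f x` to be rewritten as `h x`.
  let α' : Y → E [⋀^Fin k]→L[ℝ] ℂ := α
  have h1 : (mfderiv 𝓘(ℝ, E) 𝓘(ℝ, E) f x : E →L[ℝ] E) = mfderiv 𝓘(ℝ, E) 𝓘(ℝ, E) h x :=
    e.mfderiv_eq
  change (α' (f x)).compContinuousLinearMap (mfderiv 𝓘(ℝ, E) 𝓘(ℝ, E) f x : E →L[ℝ] E) = _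
  rw [h1, e.eq_of_nhds]
  rfl

theorem pullbackForm_comp {f : Y → Z} {h : X → Y} (α : Form E Z k) {x : X}
    (hf : MDifferentiableAt 𝓘(ℝ, E) 𝓘(ℝ, E) f (h x))
    (hh : MDifferentiableAt 𝓘(ℝ, E) 𝓘(ℝ, E) h x) :
    pullbackForm (f ∘ h) α x = pullbackForm h (pullbackForm f α) x := by
  have h1 := mfderiv_comp x hf hh
  unfold pullbackForm
  rw [h1]
  rfl

theorem pullbackForm_id (α : Form E X k) : pullbackForm id α = α := by
  funext x
  have h1 : (mfderiv 𝓘(ℝ, E) 𝓘(ℝ, E) (id : X → X) x : E →L[ℝ] E) =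
    ContinuousLinearMap.id ℝ E := mfderiv_id
  let α' : X → E [⋀^Fin k]→L[ℝ] ℂ := α
  change (α' x).compContinuousLinearMap (mfderiv 𝓘(ℝ, E) 𝓘(ℝ, E) (id : X → X) x : E →L[ℝ] E) = _
  rw [h1]
  rfl

/-- Tangent vectors at a point are vectors of `E` in the preferred chart there, so this turns facts
about ordinary derivatives of local expressions into facts about `mfderiv`. -/
theorem mfderiv_eq_fderiv_chart {f : X → Y} {x : X}
    (hf : MDifferentiableAt 𝓘(ℝ, E) 𝓘(ℝ, E) f x) :
    (mfderiv 𝓘(ℝ, E) 𝓘(ℝ, E) f x : E →L[ℝ] E) =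
      fderiv ℝ (chartAt E (f x) ∘ f ∘ (chartAt E x).symm) (chartAt E x x) := by
  rw [hf.mfderiv]
  simp [writtenInExtChartAt, fderivWithin_univ]
  rfl

variable [IsManifold 𝓘(ℝ, E) ∞ X] [IsManifold 𝓘(ℝ, E) ∞ Y]

theorem inChart_pullbackForm {f : X → Y} (hf : ContMDiff 𝓘(ℝ, E) 𝓘(ℝ, E) ∞ f) (α : Form E Y k)
    (x : X) (z : Y) {y : E} (hy : y ∈ (chartAt E x).target)
    (hz : f ((chartAt E x).symm y) ∈ (chartAt E z).source) :
    inChart x (pullbackForm f α) y =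
      (inChart z α ((chartAt E z ∘ f ∘ (chartAt E x).symm) y)).compContinuousLinearMap
        (fderiv ℝ (chartAt E z ∘ f ∘ (chartAt E x).symm) y) := by
  have hs := mdifferentiableAt_atlas_symm (I := 𝓘(ℝ, E)) (chart_mem_atlas E x) hy
  have hfd := (hf ((chartAt E x).symm y)).mdifferentiableAt (by simp)
  have hc := mdifferentiableAt_atlas (I := 𝓘(ℝ, E)) (chart_mem_atlas E z) hz
  have hcs := mdifferentiableAt_atlas_symm (I := 𝓘(ℝ, E)) (chart_mem_atlas E z)
    ((chartAt E z).map_source hz)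
  have hfs : MDifferentiableAt 𝓘(ℝ, E) 𝓘(ℝ, E) (f ∘ (chartAt E x).symm) y := hfd.comp y hs
  have hφ : MDifferentiableAt 𝓘(ℝ, E) 𝓘(ℝ, E) (chartAt E z ∘ f ∘ (chartAt E x).symm) y :=
    hc.comp y hfs
  rw [inChart_eq_pullbackForm, ← pullbackForm_comp α hfd hs]
  -- Inserting the chart at `z` and its inverse lets the chain rule split off the reading of `α` in
  -- that chart.
  have e : f ∘ (chartAt E x).symm =ᶠ[𝓝 y]
      (chartAt E z).symm ∘ chartAt E z ∘ f ∘ (chartAt E x).symm := by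
    filter_upwards [hfs.continuousAt.preimage_mem_nhds ((chartAt E z).open_source.mem_nhds hz)]
      with w hw
    exact ((chartAt E z).left_inv hw).symm
  rw [pullbackForm_congr α e, pullbackForm_comp (f := (chartAt E z).symm) (h := chartAt E z ∘ f ∘ (chartAt E x).symm) α hcs hφ, ← mfderiv_eq_fderiv]
  rfl

theorem contDiffAt_chart_comp {𝕜 : Type*} [NontriviallyNormedField 𝕜] {F : Type*}
    [NormedAddCommGroup F] [NormedSpace 𝕜 F] {M N : Type*} [TopologicalSpace M] [ChartedSpace F M]
    [TopologicalSpace N] [ChartedSpace F N] {n : ℕ∞ω} [IsManifold 𝓘(𝕜, F) n M]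
    [IsManifold 𝓘(𝕜, F) n N] {f : M → N} (hf : ContMDiff 𝓘(𝕜, F) 𝓘(𝕜, F) n f) (x : M) (z : N)
    {y : F} (hy : y ∈ (chartAt F x).target)
    (hz : f ((chartAt F x).symm y) ∈ (chartAt F z).source) :
    ContDiffAt 𝕜 n (chartAt F z ∘ f ∘ (chartAt F x).symm) y := by
  have h1 : ContMDiffAt 𝓘(𝕜, F) 𝓘(𝕜, F) n (chartAt F x).symm y :=
    (contMDiffOn_chart_symm (I := 𝓘(𝕜, F)) (x := x)).contMDiffAt
      ((chartAt F x).open_target.mem_nhds hy)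
  have h2 : ContMDiffAt 𝓘(𝕜, F) 𝓘(𝕜, F) n (chartAt F z) (f ((chartAt F x).symm y)) :=
    (contMDiffOn_chart (I := 𝓘(𝕜, F)) (x := z)).contMDiffAt
      ((chartAt F z).open_source.mem_nhds hz)
  exact (h2.comp y ((hf _).comp y h1)).contDiffAt

theorem inChart_pullbackForm_eventuallyEq {f : X → Y} (hf : ContMDiff 𝓘(ℝ, E) 𝓘(ℝ, E) ∞ f)
    (α : Form E Y k) (x : X) (z : Y) {y : E} (hy : y ∈ (chartAt E x).target)
    (hz : f ((chartAt E x).symm y) ∈ (chartAt E z).source) :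
    inChart x (pullbackForm f α) =ᶠ[𝓝 y] fun w =>
      (inChart z α ((chartAt E z ∘ f ∘ (chartAt E x).symm) w)).compContinuousLinearMap
        (fderiv ℝ (chartAt E z ∘ f ∘ (chartAt E x).symm) w) := by
  have hc : ContinuousAt (f ∘ (chartAt E x).symm) y :=
    hf.continuous.continuousAt.comp ((chartAt E x).continuousAt_symm hy)
  filter_upwards [(chartAt E x).open_target.mem_nhds hy,
    hc.preimage_mem_nhds ((chartAt E z).open_source.mem_nhds hz)] with w hw hw'
  exact inChart_pullbackForm hf α x z hw hw'

theorem IsSmoothForm.pullbackForm [FiniteDimensional ℂ E] {f : X → Y}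
    (hf : ContMDiff 𝓘(ℝ, E) 𝓘(ℝ, E) ∞ f) {α : Form E Y k} (hα : IsSmoothForm α) :
    IsSmoothForm (pullbackForm f α) := by
  have : FiniteDimensional ℝ E := FiniteDimensional.complexToReal E
  intro x y hy
  -- Smoothness is local, so the chart on `Y` may be chosen afresh at each point `y`.
  set z := f ((chartAt E x).symm y) with hz
  have hzs := mem_chart_source E z
  have hφ := contDiffAt_chart_comp hf x z hy hzs
  have h1 := ((hα z).contDiffAt ((chartAt E z).open_target.mem_nhds (mem_chart_target E z))).comp y
    hφ
  have h2 := hφ.fderiv_right (m := ∞) (by simp)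
  have h3 := contDiff_compContinuousLinearMap.contDiffAt.comp y (h1.prodMk h2)
  exact (h3.congr_of_eventuallyEq
    (inChart_pullbackForm_eventuallyEq hf α x z hy hzs)).contDiffWithinAt

/-- At `x` only the preferred charts at `x` and `f x` intervene. There the claim is naturality of
`extDeriv` in the model space, applied to the local expression of `f`; the derivatives of the charts
at their base points are the identity. -/
theorem extDer_pullbackForm {f : X → Y} (hf : ContMDiff 𝓘(ℝ, E) 𝓘(ℝ, E) ∞ f) {α : Form E Y k}
    (hα : IsSmoothForm α) : extDer (pullbackForm f α) = pullbackForm f (extDer α) := by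
  funext x
  have hy := mem_chart_target E x
  have e1 : (chartAt E x).symm (chartAt E x x) = x := (chartAt E x).left_inv (mem_chart_source E x)
  have hz : f ((chartAt E x).symm (chartAt E x x)) ∈ (chartAt E (f x)).source := by
    rw [e1]; exact mem_chart_source E (f x)
  have e2 : (chartAt E (f x) ∘ f ∘ (chartAt E x).symm) (chartAt E x x) = chartAt E (f x) (f x) := by
    simp [e1]
  have hd : DifferentiableAt ℝ (inChart (f x) α)
      ((chartAt E (f x) ∘ f ∘ (chartAt E x).symm) (chartAt E x x)) := by
    rw [e2]
    exact ((hα (f x)).contDiffAt ((chartAt E (f x)).open_target.mem_nhds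
      (mem_chart_target E (f x)))).differentiableAt (by simp)
  have h1 : extDeriv (inChart x (pullbackForm f α)) (chartAt E x x) =
      (extDeriv (inChart (f x) α) (chartAt E (f x) (f x))).compContinuousLinearMap
        (mfderiv 𝓘(ℝ, E) 𝓘(ℝ, E) f x : E →L[ℝ] E) := by
    rw [(inChart_pullbackForm_eventuallyEq hf α x (f x) hy hz).extDeriv_eq,
      extDeriv_pullback hd (contDiffAt_chart_comp hf x (f x) hy hz) (r := ∞)
      (by simpa using ENat.LEInfty.out), e2,
      mfderiv_eq_fderiv_chart ((hf x).mdifferentiableAt (by simp))]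
    rfl
  have h3 := mfderiv_self (E := E) x
  have h4 := mfderiv_self (E := E) (f x)
  unfold extDer
  rw [h1]
  change ((extDeriv (inChart (f x) α) (chartAt E (f x) (f x))).compContinuousLinearMap
    (mfderiv 𝓘(ℝ, E) 𝓘(ℝ, E) f x : E →L[ℝ] E)).compContinuousLinearMap
      (mfderiv 𝓘(ℝ, E) 𝓘(ℝ, E) (chartAt E x) x : E →L[ℝ] E) =
    ((extDeriv (inChart (f x) α) (chartAt E (f x) (f x))).compContinuousLinearMap
      (mfderiv 𝓘(ℝ, E) 𝓘(ℝ, E) (chartAt E (f x)) (f x) : E →L[ℝ] E)).compContinuousLinearMap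
      (mfderiv 𝓘(ℝ, E) 𝓘(ℝ, E) f x : E →L[ℝ] E)
  rw [h3, h4]
  rfl

end Pullback

/-! ### Invariance of the type under complex linear maps. -/

section TypePQ

variable {V : Type*} [NormedAddCommGroup V] [NormedSpace ℂ V] {p q : ℕ}

/-- Precomposition with a complex linear map keeps complex linear factors complex linear and
conjugate linear ones conjugate linear, so generators go to generators. -/
theorem typePQ_compContinuousLinearMap (T : V →ₗ[ℂ] V) (D : V →L[ℝ] V) (hD : ∀ v, D v = T v)
    {ψ : V [⋀^Fin (p + q)]→L[ℝ] ℂ} (hψ : ψ ∈ typePQ V p q) :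
    ψ.compContinuousLinearMap D ∈ typePQ V p q := by
  unfold typePQ at hψ
  induction hψ using Submodule.span_induction with
  | mem ψ h =>
    obtain ⟨a, b, hab⟩ := h
    refine Submodule.subset_span ⟨fun i => (a i).comp T, fun i => (b i).comp T, fun v => ?_⟩
    change ψ (fun i => D (v i)) = _
    rw [hab]
    simp only [hD]
    rfl
  | zero => exact Submodule.zero_mem _
  | add ψ φ _ _ h1 h2 => exact Submodule.add_mem _ h1 h2
  | smul c ψ _ h => exact Submodule.smul_mem _ c h

theorem typePQ_compContinuousLinearMap_iff [FiniteDimensional ℂ V] (T : V ≃ₗ[ℂ] V) (D : V →L[ℝ] V)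
    (hD : ∀ v, D v = T v) {ψ : V [⋀^Fin (p + q)]→L[ℝ] ℂ} :
    ψ.compContinuousLinearMap D ∈ typePQ V p q ↔ ψ ∈ typePQ V p q := by
  refine ⟨fun h => ?_, typePQ_compContinuousLinearMap T D hD⟩
  let D' : V →L[ℝ] V := (LinearMap.toContinuousLinearMap (T.symm : V →ₗ[ℂ] V)).restrictScalars ℝ
  have h1 := typePQ_compContinuousLinearMap (T.symm : V →ₗ[ℂ] V) D' (fun _ => rfl) h
  convert h1
  ext v
  change ψ v = ψ fun i => D (T.symm (v i))
  simp [hD]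

end TypePQ

/-! ### Naturality of the Hodge star, the Laplacian and the types under holomorphic maps preserving
the metrics. -/

section LocalIsometry

variable {E : Type*} [NormedAddCommGroup E] [NormedSpace ℂ E]
variable {X Y : Type*} [TopologicalSpace X] [ChartedSpace E X] [TopologicalSpace Y]
  [ChartedSpace E Y] [IsManifold 𝓘(ℂ, E) ω X] [IsManifold 𝓘(ℂ, E) ω Y]
  {gX : Metric E X} {gY : Metric E Y} {f : X → Y} {k : ℕ}

theorem contMDiff_real_of_complex {n : ℕ∞ω} (hf : ContMDiff 𝓘(ℂ, E) 𝓘(ℂ, E) n f) :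
    ContMDiff 𝓘(ℝ, E) 𝓘(ℝ, E) n f := by
  have h := contMDiff_iff.mp hf
  refine contMDiff_iff.mpr ⟨h.1, fun x y => ?_⟩
  exact (h.2 x y).restrict_scalars ℝ

/-- Holomorphic maps that preserve the metrics. -/
structure IsHolomorphicIsometry (gX : Metric E X) (gY : Metric E Y) (f : X → Y) : Prop where
  contMDiff : ContMDiff 𝓘(ℂ, E) 𝓘(ℂ, E) ω f
  inner_map (x : X) (v w : TangentSpace 𝓘(ℝ, E) x) :
    gY.inner (f x) (mfderiv 𝓘(ℝ, E) 𝓘(ℝ, E) f x v) (mfderiv 𝓘(ℝ, E) 𝓘(ℝ, E) f x w) =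
      gX.inner x v w

namespace IsHolomorphicIsometry

theorem contMDiff_real (hf : IsHolomorphicIsometry gX gY f) :
    ContMDiff 𝓘(ℝ, E) 𝓘(ℝ, E) ∞ f :=
  (contMDiff_real_of_complex hf.contMDiff).of_le (by simp)

theorem mdifferentiableAt (hf : IsHolomorphicIsometry gX gY f) (x : X) :
    MDifferentiableAt 𝓘(ℝ, E) 𝓘(ℝ, E) f x :=
  (hf.contMDiff_real x).mdifferentiableAt (by simp)

variable [FiniteDimensional ℂ E]

/-- The derivative is complex linear because `f` is holomorphic, injective because it preserves a
positive definite form, and hence bijective because source and target are the same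
finite-dimensional space `E`. -/
theorem exists_mfderiv_eq (hf : IsHolomorphicIsometry gX gY f) (x : X) :
    ∃ T : E ≃ₗ[ℂ] E, ∀ v : E, (mfderiv 𝓘(ℝ, E) 𝓘(ℝ, E) f x : E →L[ℝ] E) v = T v := by
  have e1 : (chartAt E x).symm (chartAt E x x) = x := (chartAt E x).left_inv (mem_chart_source E x)
  have hφ := (contDiffAt_chart_comp hf.contMDiff x (f x) (mem_chart_target E x)
    (by rw [e1]; exact mem_chart_source E (f x))).differentiableAt (by simp)
  have h1 := mfderiv_eq_fderiv_chart (hf.mdifferentiableAt x)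
  rw [hφ.fderiv_restrictScalars ℝ] at h1
  set A := fderiv ℂ (chartAt E (f x) ∘ f ∘ (chartAt E x).symm) (chartAt E x x)
  have hA (v : E) : (mfderiv 𝓘(ℝ, E) 𝓘(ℝ, E) f x : E →L[ℝ] E) v = A v := by rw [h1]; rfl
  have hinj : Function.Injective (A : E →ₗ[ℂ] E) := by
    refine (injective_iff_map_eq_zero _).mpr fun v hv => ?_
    by_contra hne
    have h2 := hf.inner_map x v v
    have h3 : mfderiv 𝓘(ℝ, E) 𝓘(ℝ, E) f x v = (0 : E) := (hA v).trans hv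
    have h4 := gX.pos x v hne
    rw [← h2, h3] at h4
    have h5 : gY.inner (f x) (0 : E) (0 : E) = 0 := by
      rw [show gY.inner (f x) (0 : E) = 0 from map_zero (gY.inner (f x))]
      rfl
    exact h4.ne' h5
  exact ⟨LinearEquiv.ofInjectiveEndo _ hinj, hA⟩

/-- The star depends only on the metric and the complex orientation. The derivative of `f` respects
both, being isometric and complex linear. -/
theorem starForm_pullbackForm (hf : IsHolomorphicIsometry gX gY f) (m : ℕ) (α : Form E Y k) :
    starForm gX m (pullbackForm f α) = pullbackForm f (starForm gY m α) := by
  funext x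
  obtain ⟨T, hT⟩ := hf.exists_mfderiv_eq x
  exact pointStar_comp (realBasis E) T (mfderiv 𝓘(ℝ, E) 𝓘(ℝ, E) f x) hT (gY.inner (f x))
    (gX.inner x) (fun v w => (hf.inner_map x v w).symm) k m (α (f x))

/-- The pull-back of smooth forms. -/
def pullback (hf : IsHolomorphicIsometry gX gY f) (k : ℕ) :
    SmoothForm E Y k →ₗ[ℂ] SmoothForm E X k where
  toFun α := ⟨pullbackForm f α.1, IsSmoothForm.pullbackForm hf.contMDiff_real α.2⟩
  map_add' _ _ := rfl
  map_smul' _ _ := rfl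

theorem d_pullback (hf : IsHolomorphicIsometry gX gY f) (α : SmoothForm E Y k) :
    d (hf.pullback k α) = hf.pullback (k + 1) (d α) :=
  Subtype.ext (extDer_pullbackForm hf.contMDiff_real α.2)

theorem star_pullback (hf : IsHolomorphicIsometry gX gY f) (m : ℕ) (α : SmoothForm E Y k) :
    star gX k m (hf.pullback k α) = hf.pullback m (star gY k m α) :=
  Subtype.ext (hf.starForm_pullbackForm m α.1)

theorem codiff_pullback (hf : IsHolomorphicIsometry gX gY f) (α : SmoothForm E Y (k + 1)) :
    codiff gX k (hf.pullback (k + 1) α) = hf.pullback k (codiff gY k α) := by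
  simp only [codiff, LinearMap.neg_apply, LinearMap.comp_apply, map_neg, star_pullback, d_pullback]

theorem laplacian_pullback (hf : IsHolomorphicIsometry gX gY f) (α : SmoothForm E Y k) :
    laplacian gX k (hf.pullback k α) = hf.pullback k (laplacian gY k α) := by
  cases k <;> simp only [laplacian, LinearMap.add_apply, LinearMap.comp_apply, map_add,
    codiff_pullback, d_pullback]

theorem pullback_mem_eigenformsPQ (hf : IsHolomorphicIsometry gX gY f) {p q : ℕ} {μ : ℂ}
    {α : SmoothForm E Y (p + q)} (hα : α ∈ eigenformsPQ gY p q μ) :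
    hf.pullback (p + q) α ∈ eigenformsPQ gX p q μ := by
  obtain ⟨h1, h2⟩ := hα
  refine ⟨?_, fun x => ?_⟩
  · have h1 := Module.End.mem_eigenspace_iff.mp h1
    refine Module.End.mem_eigenspace_iff.mpr ?_
    rw [hf.laplacian_pullback, h1, map_smul]
  · obtain ⟨T, hT⟩ := hf.exists_mfderiv_eq x
    exact typePQ_compContinuousLinearMap (T : E →ₗ[ℂ] E) _ hT (h2 (f x))

/-- Every point of `Y` is some `f x`, and there the derivative is invertible, so the value of the
form can be recovered. -/
theorem pullback_injective (hf : IsHolomorphicIsometry gX gY f) (hs : Function.Surjective f) :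
    Function.Injective (hf.pullback k) := by
  intro α β h
  refine Subtype.ext (funext fun y => ?_)
  obtain ⟨x, rfl⟩ := hs y
  obtain ⟨T, hT⟩ := hf.exists_mfderiv_eq x
  let α' : E [⋀^Fin k]→L[ℝ] ℂ := α.1 (f x)
  let β' : E [⋀^Fin k]→L[ℝ] ℂ := β.1 (f x)
  let D : E →L[ℝ] E := mfderiv 𝓘(ℝ, E) 𝓘(ℝ, E) f x
  have h1 : α'.compContinuousLinearMap D = β'.compContinuousLinearMap D :=
    congrFun (congrArg Subtype.val h) x
  change α' = β'
  ext v
  have h2 := DFunLike.congr_fun h1 (fun i => T.symm (v i))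
  have h3 (φ : E [⋀^Fin k]→L[ℝ] ℂ) :
      φ.compContinuousLinearMap D (fun i => T.symm (v i)) = φ v := by
    change φ (fun i => D (T.symm (v i))) = φ v
    congr 1
    funext i
    exact (hT _).trans (T.apply_symm_apply _)
  rwa [h3, h3] at h2

/-- For the converse, the eigenvalue equation holds after the injective pull-back, hence before it;
the type is detected pointwise because the derivative is an isomorphism. -/
theorem pullback_mem_eigenformsPQ_iff (hf : IsHolomorphicIsometry gX gY f)
    (hs : Function.Surjective f) {p q : ℕ} {μ : ℂ} {α : SmoothForm E Y (p + q)} :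
    hf.pullback (p + q) α ∈ eigenformsPQ gX p q μ ↔ α ∈ eigenformsPQ gY p q μ := by
  refine ⟨fun ⟨h1, h2⟩ => ⟨?_, fun y => ?_⟩, hf.pullback_mem_eigenformsPQ⟩
  · refine Module.End.mem_eigenspace_iff.mpr (hf.pullback_injective hs ?_)
    rw [← hf.laplacian_pullback, map_smul]
    exact Module.End.mem_eigenspace_iff.mp h1
  · obtain ⟨x, rfl⟩ := hs y
    obtain ⟨T, hT⟩ := hf.exists_mfderiv_eq x
    exact (typePQ_compContinuousLinearMap_iff T _ hT).mp (h2 x)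

end IsHolomorphicIsometry

end LocalIsometry

/-! ### The representation of the group on the eigenforms. -/

section Action

variable {E : Type*} [NormedAddCommGroup E] [NormedSpace ℂ E]
variable {X : Type*} [TopologicalSpace X] [ChartedSpace E X] [IsManifold 𝓘(ℂ, E) ω X]
  {g : Metric E X} {G : Type*} [Group G] [MulAction G X] [HolomorphicSMul E G X]

theorem IsIsometricAction.isHolomorphicIsometry (hG : IsIsometricAction G g) (a : G) :
    IsHolomorphicIsometry g g fun x : X => a • x :=
  ⟨HolomorphicSMul.contMDiff_smul a, hG a⟩

variable [FiniteDimensional ℂ E]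

/-- The action of `G` on the eigenforms, `α ↦ (a⁻¹)^* α`. -/
def IsIsometricAction.eigenformsRepresentation (hG : IsIsometricAction G g) (p q : ℕ) (μ : ℂ) :
    Representation ℂ G (eigenformsPQ g p q μ) where
  toFun a := ((hG.isHolomorphicIsometry a⁻¹).pullback (p + q)).restrict fun _ hα =>
    (hG.isHolomorphicIsometry a⁻¹).pullback_mem_eigenformsPQ hα
  map_one' := by
    refine LinearMap.ext fun α => Subtype.ext (Subtype.ext ?_)
    change pullbackForm (fun x : X => (1 : G)⁻¹ • x) α.1.1 = α.1.1
    simp only [inv_one, one_smul]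
    exact pullbackForm_id _
  map_mul' a b := by
    refine LinearMap.ext fun α => Subtype.ext (Subtype.ext (funext fun x => ?_))
    change pullbackForm (fun x : X => (a * b)⁻¹ • x) α.1.1 x =
      pullbackForm (fun x : X => a⁻¹ • x) (pullbackForm (fun x : X => b⁻¹ • x) α.1.1) x
    -- Pull-back reverses composition and so does inversion: `(a * b)⁻¹` acts as `a⁻¹` followed by
    -- `b⁻¹`, which gives a left action.
    rw [← pullbackForm_comp α.1.1 ((hG.isHolomorphicIsometry b⁻¹).mdifferentiableAt _)
      ((hG.isHolomorphicIsometry a⁻¹).mdifferentiableAt x)]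
    congr 1
    funext z
    simp [mul_smul]

end Action

/-! ### Descent of invariant forms to the quotient. -/

section QuotientForms

variable {E : Type*} [NormedAddCommGroup E] [NormedSpace ℂ E]
variable {X : Type*} [TopologicalSpace X] [ChartedSpace E X]
variable {Γ : Type*} [Group Γ] [MulAction Γ X] [ContinuousConstSMul Γ X] [Finite Γ]
  [IsCancelSMul Γ X] [T2Space X] [LocallyCompactSpace X] [IsManifold 𝓘(ℂ, E) ω X]
  [HolomorphicSMul E Γ X] {k : ℕ}

/-- Near `x`, the projection followed by the chosen local section is the action of one fixed `γ`; in
a chart of the quotient the projection is thus a chart of `X` composed with a holomorphic map. -/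
theorem contMDiff_complex_quotientMap :
    ContMDiff 𝓘(ℂ, E) 𝓘(ℂ, E) ω (quotientMap Γ : X → _) := by
  intro x
  rw [contMDiffAt_iff_target]
  refine ⟨(continuous_quotientMap Γ).continuousAt, ?_⟩
  obtain ⟨γ, hγ, hev⟩ := section_eventually (sectionAt (quotientMap Γ x)) (sectionAt_symm _)
    (mem_sectionAt_source (quotientMap Γ x))
  have h3 : ContMDiffAt 𝓘(ℂ, E) 𝓘(ℂ, E) ω (chartAt E (rep (quotientMap Γ x))) (γ • x) := by
    rw [hγ, sectionAt_self]
    exact (contMDiffOn_chart (I := 𝓘(ℂ, E))).contMDiffAt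
      ((chartAt E (rep (quotientMap Γ x))).open_source.mem_nhds (mem_chart_source E _))
  refine (h3.comp x (HolomorphicSMul.contMDiff_smul (E := E) γ x)).congr_of_eventuallyEq ?_
  filter_upwards [hev] with z hz
  simp [chartAt_quotient, hz]

theorem isHolomorphicIsometry_quotientMap {g : Metric E X} (hg : IsIsometricAction Γ g) :
    IsHolomorphicIsometry g (quotientMetric g hg) (quotientMap Γ) :=
  ⟨contMDiff_complex_quotientMap, quotientInner_quotientMap hg⟩

/-- The form on `Γ \ X` obtained from a form on `X` by means of the local sections of
`X → Γ \ X`. -/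
def descend (β : Form E X k) : Form E (MulAction.orbitRel.Quotient Γ X) k := fun q =>
  pullbackForm (sectionAt q) β q

/-- The local section composed with the projection is locally the action of some `γ`, under which
`β` is invariant. So the choice of sections does not matter. -/
theorem pullbackForm_quotientMap_descend {β : Form E X k}
    (hβ : ∀ γ : Γ, pullbackForm (fun x : X => γ • x) β = β) :
    pullbackForm (quotientMap Γ) (descend β) = β := by
  funext x
  obtain ⟨γ, hγ, hev⟩ := section_eventually (sectionAt (quotientMap Γ x)) (sectionAt_symm _)
    (mem_sectionAt_source (quotientMap Γ x))
  have h1 := pullbackForm_comp (f := sectionAt (quotientMap Γ x)) (h := quotientMap Γ) β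
    ((contMDiffAt_sectionAt (E := E) (quotientMap Γ x)).mdifferentiableAt (by simp))
    ((contMDiff_quotientMap (E := E) (Γ := Γ) x).mdifferentiableAt (by simp))
  exact h1.symm.trans ((pullbackForm_congr (h := fun z => γ • z) β hev).trans (congrFun (hβ γ) x))

/-- A chart of the quotient is a local section followed by a chart of `X`, so its inverse is the
inverse chart of `X` followed by the projection. -/
theorem inChart_quotient (α : Form E (MulAction.orbitRel.Quotient Γ X) k)
    (q : MulAction.orbitRel.Quotient Γ X) {y : E} (hy : y ∈ (chartAt E q).target) :
    inChart q α y = inChart (rep q) (pullbackForm (quotientMap Γ) α) y := by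
  have hy' : y ∈ (chartAt E (rep q)).target := by
    rw [chartAt_quotient] at hy
    exact hy.1
  have e1 : ⇑(chartAt E q).symm = quotientMap Γ ∘ (chartAt E (rep q)).symm := by
    rw [chartAt_quotient, OpenPartialHomeomorph.coe_trans_symm, sectionAt_symm]
  rw [inChart_eq_pullbackForm, e1, inChart_eq_pullbackForm]
  exact pullbackForm_comp α ((contMDiff_quotientMap (E := E) (Γ := Γ) _).mdifferentiableAt (by simp))
    (mdifferentiableAt_atlas_symm (chart_mem_atlas E (rep q)) hy')

/-- The sections chosen at different points need not be related, so smoothness is not visible from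
the definition. It holds because, in a chart of the quotient, the descended form has the same
coordinate expression as its pull-back, which is `β`. -/
theorem IsSmoothForm.descend {β : Form E X k} (h : IsSmoothForm β)
    (hβ : ∀ γ : Γ, KahlerQuotient.pullbackForm (fun x : X => γ • x) β = β) :
    IsSmoothForm (descend (Γ := Γ) β) := by
  intro q
  have hsub : (chartAt E q).target ⊆ (chartAt E (rep q)).target := by
    rw [chartAt_quotient]
    exact fun y hy => hy.1
  refine ((h (rep q)).mono hsub).congr fun y hy => ?_
  rw [inChart_quotient _ q hy, pullbackForm_quotientMap_descend hβ]

variable [FiniteDimensional ℂ E]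

/-- One direction is that the projection is unchanged by first acting with `γ`; the other is
descent. -/
theorem range_pullback_quotientMap {g : Metric E X} (hg : IsIsometricAction Γ g)
    (β : SmoothForm E X k) :
    (∃ α, (isHolomorphicIsometry_quotientMap hg).pullback k α = β) ↔
      ∀ γ : Γ, (hg.isHolomorphicIsometry γ).pullback k β = β := by
  constructor
  · rintro ⟨α, rfl⟩ γ
    refine Subtype.ext (funext fun x => ?_)
    refine (pullbackForm_comp α.1 ((isHolomorphicIsometry_quotientMap hg).mdifferentiableAt _)
      ((hg.isHolomorphicIsometry γ).mdifferentiableAt x)).symm.trans ?_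
    have e : quotientMap Γ ∘ (fun x : X => γ • x) = quotientMap Γ :=
      funext fun x => quotientMap_smul Γ γ x
    rw [e]
    rfl
  · intro h
    have h' (γ : Γ) : pullbackForm (fun x : X => γ • x) β.1 = β.1 := congrArg Subtype.val (h γ)
    exact ⟨⟨descend β.1, β.2.descend h'⟩, Subtype.ext (pullbackForm_quotientMap_descend h')⟩

end QuotientForms

/-! ### Eigenforms of the quotient as invariant eigenforms of `X`. -/

section EigenformsQuotient

variable {E : Type*} [NormedAddCommGroup E] [NormedSpace ℂ E] [FiniteDimensional ℂ E]
variable {X : Type*} [TopologicalSpace X] [ChartedSpace E X] [T2Space X] [LocallyCompactSpace X]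
  [IsManifold 𝓘(ℂ, E) ω X] {g : Metric E X} {G : Type*} [Group G] [Finite G] [MulAction G X]
  [ContinuousConstSMul G X] [HolomorphicSMul E G X]

/-- Pull-back along the projection is the isomorphism. An invariant eigenform descends to a smooth
form, which is itself an eigenform of type `(p, q)` because its pull-back is one. -/
theorem rank_eigenformsPQ_quotientMetric (hG : IsIsometricAction G g) (Γ : Subgroup G)
    [IsCancelSMul Γ X] (p q : ℕ) (μ : ℂ) :
    Module.rank ℂ (eigenformsPQ (quotientMetric g (hG.subgroup Γ)) p q μ) =
      Module.rank ℂ (Representation.invariants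
        ((hG.eigenformsRepresentation p q μ).comp Γ.subtype)) := by
  have hπ := isHolomorphicIsometry_quotientMap (hG.subgroup Γ)
  have hs : Function.Surjective (quotientMap Γ : X → _) := Quotient.mk_surjective
  let L := (hπ.pullback (p + q)).restrict (p := eigenformsPQ (quotientMetric g (hG.subgroup Γ)) p q μ)
    (q := eigenformsPQ g p q μ) fun _ hα => hπ.pullback_mem_eigenformsPQ hα
  have hL : Function.Injective L := fun α β h =>
    Subtype.ext (hπ.pullback_injective hs (congrArg Subtype.val h))
  have hr : LinearMap.range L = Representation.invariants
      ((hG.eigenformsRepresentation p q μ).comp Γ.subtype) := by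
    ext β
    have h1 := range_pullback_quotientMap (hG.subgroup Γ) β.1
    have h2 : β ∈ LinearMap.range L ↔ ∃ α, hπ.pullback (p + q) α = β.1 := by
      constructor
      · rintro ⟨α, rfl⟩
        exact ⟨α.1, rfl⟩
      · rintro ⟨α, hα⟩
        exact ⟨⟨α, (hπ.pullback_mem_eigenformsPQ_iff hs).mp (hα ▸ β.2)⟩, Subtype.ext hα⟩
    rw [h2, h1]
    constructor
    -- The representation lets `γ` act by pull-back along `γ⁻¹`, so the two notions of invariance
    -- match after replacing `γ` by its inverse.
    · exact fun h γ => Subtype.ext (h γ⁻¹)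
    · intro h γ
      have h3 := congrArg Subtype.val (h γ⁻¹)
      have h4 : (hG.isHolomorphicIsometry ((γ⁻¹ : Γ) : G)⁻¹).pullback (p + q) β.1 = β.1 := h3
      refine Eq.trans ?_ h4
      refine Subtype.ext ?_
      change pullbackForm (fun x : X => (γ : G) • x) β.1.1 =
        pullbackForm (fun x : X => ((γ⁻¹ : Γ) : G)⁻¹ • x) β.1.1
      simp
  rw [← hr, (LinearEquiv.ofInjective L hL).rank_eq]

end EigenformsQuotient

end KahlerQuotient
end

/-- Both multiplicities are dimensions of invariants in the same representation of `G` on the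
eigenforms of `X`, so only the comparison of the subgroups remains. -/
theorem mainTheorem2 {E : Type*} [NormedAddCommGroup E] [NormedSpace ℂ E] [FiniteDimensional ℂ E]
    {X : Type*} [TopologicalSpace X] [T2Space X] [CompactSpace X] [ChartedSpace E X]
    [IsManifold 𝓘(ℂ, E) ω X] (g : KahlerQuotient.Metric E X) (hK : KahlerQuotient.IsKahler g)
    {G : Type*} [Group G] [Finite G] [MulAction G X] [ContinuousConstSMul G X]
    [KahlerQuotient.HolomorphicSMul E G X] (hG : KahlerQuotient.IsIsometricAction G g)
    (Γ₁ Γ₂ : Subgroup G) [IsCancelSMul Γ₁ X] [IsCancelSMul Γ₂ X]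
    (hΓ : KahlerQuotient.AlmostConjugate Γ₁ Γ₂) (p q : ℕ) :
    KahlerQuotient.IsospectralPQ (KahlerQuotient.quotientMetric g (hG.subgroup Γ₁))
      (KahlerQuotient.quotientMetric g (hG.subgroup Γ₂)) p q := by
  intro μ
  rw [KahlerQuotient.rank_eigenformsPQ_quotientMetric hG Γ₁,
    KahlerQuotient.rank_eigenformsPQ_quotientMetric hG Γ₂, hΓ.rank_invariants_eq]
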